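/- Let $q=p^h$ with $p$ prime, let $m>1$ be a divisor of $n$, put $r=n/m$, and let $k\ge 1$ with $\gcd(k,n)=1$. For $a\in\mathbb F_{q^n}$ and $0\le j\le m-1$ let $f^{(k)}_{a,j}$ be the $\mathbb F_q$-bilinear form on $\mathbb F_{q^m}\times\mathbb F_{q^n}$ given by $$f^{(k)}_{a,j}(x,x')=\mathrm{Tr}_{q^n/q}\bigl(a\,x\,x'^{\,q^{kj}}\bigr),$$ and let $\Omega^{(k)}_j=\{f^{(k)}_{a,j}:a\in\mathbb F_{q^n}\}$. For $t\in\{1,\dots,m-2\}$, $\mu\in\mathbb F_{q^n}$ and an integer $s$ let $$\mathcal H^{(k)}_{m,n,t,\mu,s}=\{f^{(k)}_{a,0}+f^{(k)}_{\mu a^{q^{sk}},t}:a\in\mathbb F_{q^n}\}\oplus\Omega^{(k)}_1\oplus\dots\oplus\Omega^{(k)}_{t-1},$$ the code obtained by puncturing (restricting to $\mathbb F_{q^m}\times\mathbb F_{q^n}$) the generalized twisted Gabidulin code $\mathcal H^{(k)}_{n,n,t,\mu,s}$ of bilinear forms on $\mathbb F_{q^n}\times\mathbb F_{q^n}$. (A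 power $x^{q^z}$ with $z\in\mathbb Z$ is the image of $x$ under the $z$-th power of the automorphism $x\mapsto x^q$ of the field.) Let $\Omega_{m,n}$ be the space of all $\mathbb F_q$-bilinear forms on $\mathbb F_{q^m}\times\mathbb F_{q^n}$; the rank of a form is the codimension of its left radical. Two subsets of $\Omega_{m,n}$ are equivalent if an invertible semilinear rank-preserving transformation of $\Omega_{m,n}$ maps the first onto the second. Let $t\in\{1,\dots,m-2\}$, let $s,u$ be integers with $s\not\equiv 0,\pm1,\pm2\pmod m$, and let $\mu,\nu\in\mathbb F_{q^n}$ with $\mu\ne0$ and $\mathrm N_{q^n/q}(\mu)\ne(-1)^{nt}\ne \mathrm N_{q^n/q}(\nu)$. Consider the condition $(\ast)$ There exist $j\in\{0,\dots,r-1\}$ with $s\equiv u+jm\pmod n$, an integer $e\ge0$, an integer $i$, a non-zero $a\in\mathbb F_{q^m}$ and elements $b_0,b_m,\dots,b_{(r-1)m}\in\mathbb F_{q^n}$ such that $$a\,\mu^{p^e q^{k((r-h)m+i)}}\,b_{hm}^{\,q^{k((r-h)m+t)}}=a^{q^{ku}}\,\nu\, b_{(h-j)m}^{\,q^{k((j-h)m+u)}}\qquad\text{for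 } 0\le h\le r-1$$ (indices of $b$ modulo $n$), and such that the $n\times n$ $q^k$-circulant matrix with $(x,y)$ entry $b_{y-x}^{\,q^{kx}}$ $(0\le x,y\le n-1)$ is non-singular, where $b_l=0$ for every $l$ not divisible by $m$. If $m<n$, then $\mathcal H^{(k)}_{m,n,t,\mu,s}$ and $\mathcal H^{(k)}_{m,n,t,\nu,u}$ are equivalent if and only if $(\ast)$ holds. If $m=n$, then some transformation of the form $f\mapsto f^\tau$, $f^\tau(v,v')=\theta\bigl(f(g v,g' v')\bigr)$, with $\theta\in\mathrm{Aut}(\mathbb F_q)$ and $g,g'$ invertible $\theta^{-1}$-semilinear maps (that is, an element of $(\mathrm{GL}(V)\times\mathrm{GL}(V'))\rtimes\mathrm{Aut}(\mathbb F_q)$, where $V=\mathbb F_{q^m}$ and $V'=\mathbb F_{q^n}$), maps $\mathcal H^{(k)}_{m,n,t,\mu,s}$ onto $\mathcal H^{(k)}_{m,n,t,\nu,u}$ if and only if $(\ast)$ holds. -/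

import Mathlib

namespace PuncturedCodes

noncomputable section

section RankMetric

variable {K V V' : Type*} [Field K] [AddCommGroup V] [Module K V] [AddCommGroup V'] [Module K V']

/-- The rank of a bilinear form `f` on `V × V'`: the codimension of its left radical
`{v | ∀ v', f v v' = 0}`, which is the kernel of `f` seen as a map `V → (V' → K)`. -/
def formRank (f : V →ₗ[K] V' →ₗ[K] K) : ℕ :=
  Module.finrank K V - Module.finrank K (LinearMap.ker f)

/-- An automorphism of the rank metric space `Ω(V, V')` of all bilinear forms on `V × V'`: an
invertible semilinear transformation of `Ω(V, V')` that preserves the rank. -/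
def IsRankAut (τ : (V →ₗ[K] V' →ₗ[K] K) ≃+ (V →ₗ[K] V' →ₗ[K] K)) : Prop :=
  (∃ θ : K ≃+* K, ∀ (c : K) (f : V →ₗ[K] V' →ₗ[K] K), τ (c • f) = θ c • τ f) ∧
    ∀ f : V →ₗ[K] V' →ₗ[K] K, formRank (τ f) = formRank f

/-- Two sets of bilinear forms are equivalent if some automorphism of the rank metric space
`Ω(V, V')` maps the first one onto the second one. -/
def CodeEquiv (X₁ X₂ : Set (V →ₗ[K] V' →ₗ[K] K)) : Prop :=
  ∃ τ : (V →ₗ[K] V' →ₗ[K] K) ≃+ (V →ₗ[K] V' →ₗ[K] K), IsRankAut τ ∧ τ '' X₁ = X₂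

/-- The transformations in `(GL(V) × GL(V')) ⋊ Aut(K)`, that is
`f ↦ ((v, v') ↦ θ (f (g v, g' v')))` with `θ ∈ Aut(K)` and `g`, `g'` invertible and semilinear
with respect to `θ⁻¹` (so that the result is again bilinear). -/
def IsProductAut (τ : (V →ₗ[K] V' →ₗ[K] K) ≃+ (V →ₗ[K] V' →ₗ[K] K)) : Prop :=
  ∃ (θ : K ≃+* K) (g : V ≃+ V) (g' : V' ≃+ V'),
    (∀ (c : K) (v : V), g (c • v) = θ.symm c • g v) ∧
    (∀ (c : K) (v' : V'), g' (c • v') = θ.symm c • g' v') ∧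
    ∀ (f : V →ₗ[K] V' →ₗ[K] K) (v : V) (v' : V'), τ f v v' = θ (f (g v) (g' v'))

/-- Equivalence of two sets of bilinear forms under the group `(GL(V) × GL(V')) ⋊ Aut(K)`. -/
def ProductEquiv (X₁ X₂ : Set (V →ₗ[K] V' →ₗ[K] K)) : Prop :=
  ∃ τ : (V →ₗ[K] V' →ₗ[K] K) ≃+ (V →ₗ[K] V' →ₗ[K] K), IsProductAut τ ∧ τ '' X₁ = X₂

end RankMetric

section Frobenius

variable (K : Type*) {L : Type*} [Field K] [Fintype K] [Field L] [Finite L] [Algebra K L]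

/-- `frobPow K z` is the automorphism `x ↦ x ^ (q ^ z)` of `L` over `K`, with `q = |K|` and any
integer `z`; a negative `z` means a power of the inverse of `x ↦ x ^ q`. -/
def frobPow (z : ℤ) : L ≃ₐ[K] L := FiniteField.frobeniusAlgEquivOfAlgebraic K L ^ z

theorem frobPow_natCast (z : ℕ) (x : L) : frobPow K (z : ℤ) x = x ^ Fintype.card K ^ z := by
  have h := congrFun (FiniteField.coe_frobeniusAlgEquivOfAlgebraic_iterate K L z) x
  rw [frobPow, zpow_natCast, AlgEquiv.coe_pow]
  exact h

end Frobenius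

section Codes

variable (K F L : Type*) [Field K] [Fintype K] [Field F] [Field L] [Finite L]
  [Algebra K F] [Algebra K L] [Algebra F L] [IsScalarTower K F L]

/-- The `k`-cyclic model `{(x, x^{q^k}, …, x^{q^{k(n-1)}})}` of an `n`-dimensional space is
parametrised by `x ∈ L = 𝔽_{q^n}`. In this parameter, `cyclicForm K L k j a` is the bilinear form
`f_{a,j}^{(k)}(x, x') = Tr_{L/K}(a x x'^{q^{kj}})`. -/
def cyclicForm (k j : ℕ) (a : L) : L →ₗ[K] L →ₗ[K] K :=
  LinearMap.mk₂ K (fun x x' => Algebra.trace K L (a * x * frobPow K ((k * j : ℕ) : ℤ) x'))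
    (fun x y x' => by rw [mul_add, add_mul, map_add])
    (fun c x x' => by rw [mul_smul_comm, smul_mul_assoc, map_smul])
    (fun x y z => by rw [map_add, mul_add, map_add])
    (fun c x x' => by rw [map_smul, mul_smul_comm, map_smul])

theorem cyclicForm_apply (k j : ℕ) (a x x' : L) :
    cyclicForm K L k j a x x' = Algebra.trace K L (a * x * frobPow K ((k * j : ℕ) : ℤ) x') := rfl

theorem cyclicForm_add (k j : ℕ) (a b : L) :
    cyclicForm K L k j (a + b) = cyclicForm K L k j a + cyclicForm K L k j b := by
  ext x x'
  simp only [cyclicForm_apply, LinearMap.add_apply, add_mul, map_add]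

theorem cyclicForm_smul (k j : ℕ) (c : K) (a : L) :
    cyclicForm K L k j (c • a) = c • cyclicForm K L k j a := by
  ext x x'
  simp only [cyclicForm_apply, LinearMap.smul_apply, smul_mul_assoc, map_smul]

/-- `Ω_j^{(k)} = {f_{a,j}^{(k)} : a ∈ L}`. -/
def component (k j : ℕ) : Submodule K (L →ₗ[K] L →ₗ[K] K) :=
  LinearMap.range
    ({ toFun := cyclicForm K L k j
       map_add' := cyclicForm_add K L k j
       map_smul' := cyclicForm_smul K L k j } : L →ₗ[K] L →ₗ[K] L →ₗ[K] K)

/-- `Γ_{n,n,t,μ,s}^{(k)} = {f_{a,0}^{(k)} + f_{μ a^{q^{sk}},t}^{(k)} : a ∈ L}`. -/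
def twistedPart (k t : ℕ) (μ : L) (s : ℤ) : Submodule K (L →ₗ[K] L →ₗ[K] K) :=
  LinearMap.range
    ({ toFun := fun a => cyclicForm K L k 0 a + cyclicForm K L k t (μ * frobPow K (s * k) a)
       map_add' := fun a b => by
         rw [map_add, mul_add, cyclicForm_add, cyclicForm_add]
         abel
       map_smul' := fun c a => by
         rw [map_smul, mul_smul_comm, cyclicForm_smul, cyclicForm_smul, RingHom.id_apply,
           smul_add] } : L →ₗ[K] L →ₗ[K] L →ₗ[K] K)

/-- The generalized twisted Gabidulin code
`H_{n,n,t,μ,s}^{(k)} = Γ_{n,n,t,μ,s}^{(k)} + Ω_1^{(k)} + … + Ω_{t-1}^{(k)}`. -/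
def twistedGabidulin (k t : ℕ) (μ : L) (s : ℤ) : Submodule K (L →ₗ[K] L →ₗ[K] K) :=
  twistedPart K L k t μ s ⊔ ⨆ j ∈ Finset.Icc 1 (t - 1), component K L k j

/-- Restriction of a bilinear form from `L × L` to `F × L`, where `F = 𝔽_{q^m} ⊆ L = 𝔽_{q^n}`.
In the `k`-th Singer bases the vectors `s_i = ∑_j s'_{i+jm}` span the `k`-cyclic model of the
`m`-dimensional space inside that of the `n`-dimensional space, and the vector of the former with
parameter `x ∈ F` is the vector of the latter with the same parameter `x`; so this is left
multiplication of the matrix of the form by `(I_m | I_m | ⋯ | I_m)`. -/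
def puncture : (L →ₗ[K] L →ₗ[K] K) →ₗ[K] (F →ₗ[K] L →ₗ[K] K) :=
  LinearMap.lcomp K (L →ₗ[K] K) (IsScalarTower.toAlgHom K F L).toLinearMap

theorem puncture_apply (f : L →ₗ[K] L →ₗ[K] K) (x : F) (x' : L) :
    puncture K F L f x x' = f (algebraMap F L x) x' := rfl

/-- The punctured code `H_{m,n,t,μ,s}^{(k)}`, a subspace of the space of all bilinear forms on
`F × L`, with `F = 𝔽_{q^m}` and `L = 𝔽_{q^n}`. -/
def puncturedTwistedGabidulin (k t : ℕ) (μ : L) (s : ℤ) :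
    Submodule K (F →ₗ[K] L →ₗ[K] K) :=
  (twistedGabidulin K L k t μ s).map (puncture K F L)

/-- The `n × n` `q^k`-circulant matrix generated by the array `b = (b_0, …, b_{n-1})`: its
`(i, j)` entry is `b_{j-i}^{q^{ki}}`, the index of `b` being taken modulo `n`. -/
def circulant {n : ℕ} (k : ℕ) (b : ZMod n → L) : Matrix (Fin n) (Fin n) L :=
  Matrix.of fun i j => frobPow K ((k * i.val : ℕ) : ℤ) (b ((j.val : ZMod n) - (i.val : ZMod n)))

/-- The arithmetic condition on `μ, s` and `ν, u`. Here `r = n / m`; the array `b` is indexed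
modulo `n` and vanishes outside the positions `0, m, …, (r-1)m`. Every exponent of `q` is
multiplied by `k`, since `q^k` plays the role of `q` in the `k`-cyclic model. -/
def EquivCondition (p m n k t : ℕ) (μ ν : L) (s u : ℤ) : Prop :=
  ∃ j ∈ Finset.range (n / m), s ≡ u + j * m [ZMOD n] ∧
    ∃ (e : ℕ) (i : ℤ) (a : F) (b : ZMod n → L),
      a ≠ 0 ∧
      (∀ l : ZMod n, b l ≠ 0 → ∃ h : ℕ, l = ((h * m : ℕ) : ZMod n)) ∧
      (circulant K L k b).det ≠ 0 ∧
      ∀ h ∈ Finset.range (n / m),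
        algebraMap F L a *
            frobPow K (k * ((((n / m : ℕ) : ℤ) - h) * m + i)) (μ ^ p ^ e) *
            frobPow K (k * ((((n / m : ℕ) : ℤ) - h) * m + t)) (b ((h * m : ℕ) : ZMod n)) =
          frobPow K (k * u) (algebraMap F L a) * ν *
            frobPow K (k * (((j : ℤ) - h) * m + u)) (b (((h : ZMod n) - (j : ZMod n)) * m))

end Codes

end

end PuncturedCodes

/-!
If `m < n`, the maximal spaces of forms of rank at most one are of two kinds, of dimensions `m` and
`n`. A rank-preserving semilinear bijection cannot exchange them, so it is a product map
`f ↦ θ (f (g ·) (g' ·))`, and only product maps have to be studied.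

Every form is `(x, y) ↦ Tr (C(x) y)` for a unique linearized polynomial `C = ∑ cₗ x^(l)`, where
`x^(l) = x ^ (q ^ (κ l))` and `κ = -k`; the sign comes from `Tr (a x y^σ) = Tr ((a x)^(σ⁻¹) y)`.
The code becomes the set of those `C` supported on `{0, …, t}` whose coefficient `c_t` is determined
by `c₀` through `μ` and `s`. As `θ` extends to a power of the Frobenius automorphism, a product map
is `C ↦ B ∘ C ∘ A` up to this power, with invertible linearized polynomials `A` and `B`.

The image of the code must have no coefficients outside `{0, …, t}`. The resulting bilinear
relations between the coefficients of `A` and `B`, together with `s ≢ 0, ±1, ±2 (mod m)`, force `A`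
to be a monomial of some degree `i` and `B` to be supported on the residue class of `-i` modulo `m`.
For such `A` and `B`, comparing the coefficients `c₀` and `c_t` gives the relations of the
condition, and `B` is invertible if and only if its circulant matrix is non-singular.
-/

namespace PuncturedCodes

noncomputable section

section RankOne

open LinearMap Module Submodule

variable {K V W : Type*} [Field K] [AddCommGroup V] [Module K V] [AddCommGroup W] [Module K W]

theorem forall_eq_or_forall_eq {ι α β : Type*} {f : ι → α} {g : ι → β}
    (h : ∀ i j, f i = f j ∨ g i = g j) : (∀ i j, f i = f j) ∨ ∀ i j, g i = g j := by
  by_contra! hne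
  obtain ⟨⟨i, j, hij⟩, k, l, hkl⟩ := hne
  grind [h i j, h k l, h i k, h i l, h j k, h j l]

theorem exists_comp_eq_of_range_le {U : Type*} [AddCommGroup U] [Module K U] {f : U →ₗ[K] W}
    {g : V →ₗ[K] W} (hg : Function.Injective g) (h : range f ≤ range g) :
    ∃ T : U →ₗ[K] V, g ∘ₗ T = f := by
  obtain ⟨g', hg'⟩ := g.exists_leftInverse_of_injective (ker_eq_bot.2 hg)
  refine ⟨g' ∘ₗ f, LinearMap.ext fun u => ?_⟩
  obtain ⟨v, hv⟩ := h (mem_range_self f u)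
  have hg'v : g' (g v) = v := LinearMap.congr_fun hg' v
  rw [comp_apply, comp_apply, ← hv, hg'v]

theorem smulRightₗ_eq_zero_iff {φ : Dual K V} {w : W} :
    smulRightₗ φ w = 0 ↔ φ = 0 ∨ w = 0 := by
  rw [smulRightₗ_apply]
  exact smulRight_apply_eq_zero_iff

theorem smulRightₗ_injective {φ : Dual K V} (hφ : φ ≠ 0) :
    Function.Injective (smulRightₗ φ : W →ₗ[K] V →ₗ[K] W) :=
  (injective_iff_map_eq_zero _).2 fun _ h => (smulRightₗ_eq_zero_iff.1 h).resolve_left hφ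

theorem smulRightₗ_flip_injective {w : W} (hw : w ≠ 0) :
    Function.Injective (smulRightₗ.flip w : Dual K V →ₗ[K] V →ₗ[K] W) :=
  (injective_iff_map_eq_zero _).2 fun _ h => (smulRightₗ_eq_zero_iff.1 h).resolve_right hw

theorem finrank_range_le_one_iff [FiniteDimensional K V] {f : V →ₗ[K] W} :
    finrank K (range f) ≤ 1 ↔ ∃ φ w, f = smulRightₗ φ w := by
  constructor
  · intro hf
    obtain ⟨w, hw⟩ := (finrank_le_one_iff_isPrincipal _).1 hf
    by_cases hw0 : w = 0
    · refine ⟨0, 0, ?_⟩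
      rw [map_zero, ← range_eq_bot, hw, hw0, span_zero_singleton]
    · obtain ⟨φ, hφ⟩ := exists_comp_eq_of_range_le (f := f) (g := toSpanSingleton K W w)
        (ker_eq_bot.1 (ker_toSpanSingleton K hw0)) (by rw [hw, range_toSpanSingleton])
      exact ⟨φ, w, hφ.symm⟩
  · rintro ⟨φ, w, rfl⟩
    have hle : range (smulRightₗ φ w) ≤ span K {w} := by
      rintro _ ⟨v, rfl⟩
      exact smul_mem _ _ (mem_span_singleton_self w)
    exact (finrank_mono hle).trans (by simpa using finrank_span_le_card (R := K) {w})

theorem exists_apply_eq_zero_apply_ne_zero {φ₁ φ₂ : Dual K V} (h : φ₂ ∉ span K {φ₁}) :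
    ∃ v, φ₁ v = 0 ∧ φ₂ v ≠ 0 := by
  by_contra! hv
  have hmem := mem_span_of_iInf_ker_le_ker (L := fun _ : Unit => φ₁) (K := φ₂)
    (by rw [iInf_const]; exact fun v hφ => hv v hφ)
  rw [Set.range_const] at hmem
  exact h hmem

theorem span_singleton_eq_of_mem {x y : V} (hx : x ≠ 0) (h : x ∈ span K {y}) :
    span K {x} = span K {y} := by
  obtain ⟨c, rfl⟩ := mem_span_singleton.1 h
  exact span_singleton_smul_eq (IsUnit.mk0 c (by rintro rfl; simp at hx)) y

theorem smulRightₗ_mem_range_smulRightₗ {φ φ₀ : Dual K V} (h : span K {φ} = span K {φ₀}) (w : W) :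
    smulRightₗ φ w ∈ range (smulRightₗ φ₀ : W →ₗ[K] V →ₗ[K] W) := by
  obtain ⟨c, rfl⟩ := mem_span_singleton.1 (h ▸ mem_span_singleton_self φ)
  exact ⟨c • w, by rw [map_smul, map_smul, LinearMap.smul_apply]⟩

theorem smulRightₗ_mem_range_smulRightₗ_flip {w w₀ : W} (h : span K {w} = span K {w₀})
    (φ : Dual K V) : smulRightₗ φ w ∈ range (smulRightₗ.flip w₀ : Dual K V →ₗ[K] V →ₗ[K] W) := by
  obtain ⟨c, rfl⟩ := mem_span_singleton.1 (h ▸ mem_span_singleton_self w)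
  exact ⟨c • φ, by rw [flip_apply, map_smul, map_smul, LinearMap.smul_apply]⟩

theorem span_eq_span_of_smulRightₗ_add {φ φ₁ φ₂ : Dual K V} {w w₁ w₂ : W}
    (h : smulRightₗ φ₁ w₁ + smulRightₗ φ₂ w₂ = smulRightₗ φ w) (hφ₂ : φ₂ ≠ 0) (hw₂ : w₂ ≠ 0)
    (hne : span K {φ₁} ≠ span K {φ₂}) : span K {w₂} = span K {w} := by
  obtain ⟨v, hv₁, hv₂⟩ := exists_apply_eq_zero_apply_ne_zero
    fun hmem => hne (span_singleton_eq_of_mem hφ₂ hmem).symm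
  have hv : φ₂ v • w₂ = φ v • w := by simpa [hv₁] using LinearMap.congr_fun h v
  refine span_singleton_eq_of_mem hw₂ (mem_span_singleton.2 ⟨(φ₂ v)⁻¹ * φ v, ?_⟩)
  rw [mul_smul, ← hv, inv_smul_smul₀ hv₂]

theorem span_eq_or_span_eq_of_smulRightₗ_add {φ φ₁ φ₂ : Dual K V} {w w₁ w₂ : W}
    (h : smulRightₗ φ₁ w₁ + smulRightₗ φ₂ w₂ = smulRightₗ φ w)
    (hφ₁ : φ₁ ≠ 0) (hφ₂ : φ₂ ≠ 0) (hw₁ : w₁ ≠ 0) (hw₂ : w₂ ≠ 0) :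
    span K {φ₁} = span K {φ₂} ∨ span K {w₁} = span K {w₂} := by
  refine or_iff_not_imp_left.2 fun hne => ?_
  rw [span_eq_span_of_smulRightₗ_add h hφ₂ hw₂ hne,
    span_eq_span_of_smulRightₗ_add ((add_comm _ _).trans h) hφ₁ hw₁ (Ne.symm hne)]

theorem exists_le_range_smulRightₗ_or_flip {S : Submodule K (V →ₗ[K] W)}
    (hS : ∀ f ∈ S, ∃ φ w, f = smulRightₗ φ w) :
    (∃ φ, S ≤ range (smulRightₗ φ)) ∨ ∃ w, S ≤ range (smulRightₗ.flip w) := by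
  choose! φ w hφw using hS
  obtain rfl | hbot := eq_or_ne S ⊥
  · exact Or.inl ⟨0, bot_le⟩
  obtain ⟨f₀, hf₀S, hf₀⟩ := exists_mem_ne_zero_of_ne_bot hbot
  have hne : ∀ f ∈ S, f ≠ 0 → φ f ≠ 0 ∧ w f ≠ 0 := fun f hf h => by
    rwa [hφw f hf, Ne, smulRightₗ_eq_zero_iff, not_or] at h
  refine (forall_eq_or_forall_eq (f := fun f : {f // f ∈ S ∧ f ≠ 0} => span K {φ f})
    (g := fun f => span K {w f}) ?_).imp (fun h => ⟨φ f₀, fun f hf => ?_⟩)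
    fun h => ⟨w f₀, fun f hf => ?_⟩
  · rintro ⟨f₁, hf₁S, hf₁⟩ ⟨f₂, hf₂S, hf₂⟩
    refine span_eq_or_span_eq_of_smulRightₗ_add (φ := φ (f₁ + f₂)) (w := w (f₁ + f₂)) ?_
      (hne f₁ hf₁S hf₁).1 (hne f₂ hf₂S hf₂).1 (hne f₁ hf₁S hf₁).2 (hne f₂ hf₂S hf₂).2
    rw [← hφw f₁ hf₁S, ← hφw f₂ hf₂S, ← hφw _ (S.add_mem hf₁S hf₂S)]
  · obtain rfl | hf0 := eq_or_ne f 0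
    · exact zero_mem _
    · rw [hφw f hf]
      exact smulRightₗ_mem_range_smulRightₗ (h ⟨f, hf, hf0⟩ ⟨f₀, hf₀S, hf₀⟩) _
  · obtain rfl | hf0 := eq_or_ne f 0
    · exact zero_mem _
    · rw [hφw f hf]
      exact smulRightₗ_mem_range_smulRightₗ_flip (h ⟨f, hf, hf0⟩ ⟨f₀, hf₀S, hf₀⟩) _

theorem mem_span_of_smulRightₗ_eq {φ φ₀ : Dual K V} {w w₀ : W} (hw : w ≠ 0)
    (h : smulRightₗ φ w = smulRightₗ φ₀ w₀) : φ ∈ span K {φ₀} := by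
  by_contra hφ
  obtain ⟨v, hv₀, hv⟩ := exists_apply_eq_zero_apply_ne_zero hφ
  have hvw : φ v = 0 ∨ w = 0 := by simpa [hv₀] using LinearMap.congr_fun h v
  exact hvw.elim hv hw

theorem eq_of_forall_smulRightₗ_eq [FiniteDimensional K V] {U : Type*} [AddCommGroup U] [Module K U]
    {σ σ' : (V →ₗ[K] W) →ₗ[K] U} (h : ∀ φ w, σ (smulRightₗ φ w) = σ' (smulRightₗ φ w)) :
    σ = σ' := by
  ext f
  let b := finBasis K V
  have hf : f = ∑ i, smulRightₗ (b.coord i) (f (b i)) :=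
    b.ext fun i => by simp [LinearMap.sum_apply, Finsupp.single_apply]
  rw [hf, map_sum, map_sum]
  exact Finset.sum_congr rfl fun i _ => h _ _

end RankOne

section RankPreserver

open LinearMap Module Submodule

variable {K V W : Type*} [Field K] [AddCommGroup V] [Module K V] [AddCommGroup W] [Module K W]
  [FiniteDimensional K V] [FiniteDimensional K W] {σ : (V →ₗ[K] W) →ₗ[K] V →ₗ[K] W}

theorem exists_left_factor (hσ : Function.Injective σ)
    (hrank : ∀ φ w, ∃ φ' w', σ (smulRightₗ φ w) = smulRightₗ φ' w')
    (hdim : finrank K V < finrank K W) {φ : Dual K V} (hφ : φ ≠ 0) :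
    ∃ φ' ≠ 0, ∃ T : W ≃ₗ[K] W, ∀ w, σ (smulRightₗ φ w) = smulRightₗ φ' (T w) := by
  have hinj : Function.Injective (σ ∘ₗ smulRightₗ φ : W →ₗ[K] V →ₗ[K] W) :=
    hσ.comp (smulRightₗ_injective hφ)
  have hfin := finrank_range_of_inj hinj
  obtain ⟨φ', hφ'⟩ | ⟨w, hw⟩ := exists_le_range_smulRightₗ_or_flip
    (S := range (σ ∘ₗ smulRightₗ φ)) (by rintro _ ⟨w, rfl⟩; exact hrank φ w)
  · have hφ'0 : φ' ≠ 0 := by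
      rintro rfl
      rw [map_zero, range_zero, le_bot_iff] at hφ'
      rw [hφ', finrank_bot] at hfin
      exact (Nat.zero_le _).not_gt (hfin ▸ hdim)
    obtain ⟨T, hT⟩ := exists_comp_eq_of_range_le (smulRightₗ_injective hφ'0) hφ'
    have hTinj : Function.Injective T := by
      rw [← hT, coe_comp] at hinj
      exact hinj.of_comp
    exact ⟨φ', hφ'0, LinearEquiv.ofInjectiveEndo T hTinj, fun w => (LinearMap.congr_fun hT w).symm⟩
  · have hle := (finrank_mono hw).trans (finrank_range_le _)
    rw [hfin, Subspace.dual_finrank_eq] at hle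
    exact absurd hdim hle.not_gt

theorem exists_right_factor (hσ : Function.Injective σ)
    (hrank : ∀ φ w, ∃ φ' w', σ (smulRightₗ φ w) = smulRightₗ φ' w')
    (hdim : finrank K V < finrank K W) [Nontrivial V] [Nontrivial W] :
    ∃ T : W ≃ₗ[K] W, ∀ φ, ∃ φ', ∀ w, σ (smulRightₗ φ w) = smulRightₗ φ' (T w) := by
  obtain ⟨φ₀, hφ₀⟩ := exists_ne (0 : Dual K V)
  obtain ⟨φ₀', hφ₀', T₀, hT₀⟩ := exists_left_factor hσ hrank hdim hφ₀
  refine ⟨T₀, fun φ => ?_⟩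
  by_cases hφ : φ ∈ span K {φ₀}
  · obtain ⟨c, rfl⟩ := mem_span_singleton.1 hφ
    exact ⟨c • φ₀', fun w => by simp only [map_smul, LinearMap.smul_apply, hT₀]⟩
  have hφ0 : φ ≠ 0 := by
    rintro rfl
    exact hφ (zero_mem _)
  obtain ⟨φ', hφ', T, hT⟩ := exists_left_factor hσ hrank hdim hφ0
  have hspan : span K {φ₀'} ≠ span K {φ'} := by
    intro heq
    obtain ⟨w, hw⟩ := exists_ne (0 : W)
    obtain ⟨y, hy⟩ := smulRightₗ_mem_range_smulRightₗ heq.symm (T w)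
    refine hφ (mem_span_of_smulRightₗ_eq (w₀ := T₀.symm y) hw (hσ ?_))
    rw [hT, hT₀, T₀.apply_symm_apply, hy]
  have hdep : ∀ w, ¬ LinearIndependent K ![w, T (T₀.symm w)] := by
    intro w hw
    have hw₁ : w ≠ 0 := hw.ne_zero 0
    have hw₂ : T (T₀.symm w) ≠ 0 := hw.ne_zero 1
    obtain ⟨ψ, y, hψ⟩ := hrank (φ₀ + φ) (T₀.symm w)
    have hsum : smulRightₗ φ₀' w + smulRightₗ φ' (T (T₀.symm w)) = smulRightₗ ψ y := by
      rw [← hψ, map_add, LinearMap.add_apply, map_add, hT₀, hT, T₀.apply_symm_apply]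
    have hspan' := (span_eq_or_span_eq_of_smulRightₗ_add hsum hφ₀' hφ' hw₁ hw₂).resolve_left hspan
    obtain ⟨c, hc⟩ := mem_span_singleton.1 (hspan' ▸ mem_span_singleton_self (T (T₀.symm w)))
    exact (LinearIndependent.pair_iff' hw₁).1 hw c hc
  obtain ⟨c, hc⟩ := LinearMap.exists_eq_smul_id_of_forall_notLinearIndependent
    (f := T.toLinearMap ∘ₗ T₀.symm.toLinearMap) hdep
  refine ⟨c • φ', fun w => ?_⟩
  have hcw : T w = c • T₀ w := by simpa using LinearMap.congr_fun hc (T₀ w)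
  rw [hT, hcw, map_smul, map_smul, LinearMap.smul_apply]

omit [FiniteDimensional K W] in
theorem exists_linearEquiv_of_injective_dual {X : Dual K V →ₗ[K] Dual K V}
    (hX : Function.Injective X) : ∃ g : V ≃ₗ[K] V, ∀ φ v, φ (g v) = X φ v :=
  ⟨evalEquiv K V ≪≫ₗ (LinearEquiv.ofInjectiveEndo X hX).dualMap ≪≫ₗ (evalEquiv K V).symm,
    fun φ _ => apply_evalEquiv_symm_apply K V φ _⟩

theorem exists_eq_comp_comp_of_rank_one_preserver (hσ : Function.Injective σ)
    (hrank : ∀ φ w, ∃ φ' w', σ (smulRightₗ φ w) = smulRightₗ φ' w')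
    (hdim : finrank K V < finrank K W) :
    ∃ (g : V ≃ₗ[K] V) (T : W ≃ₗ[K] W), ∀ f, σ f = T.toLinearMap ∘ₗ f ∘ₗ g.toLinearMap := by
  obtain hV | hV := subsingleton_or_nontrivial V
  · exact ⟨.refl K V, .refl K W, fun f => Subsingleton.elim _ _⟩
  have hW : Nontrivial W := finrank_pos_iff.1 ((Nat.zero_le _).trans_lt hdim)
  obtain ⟨T, hT⟩ := exists_right_factor hσ hrank hdim
  obtain ⟨w₁, hw₁⟩ := exists_ne (0 : W)
  have hTw₁ : T w₁ ≠ 0 := (map_ne_zero_iff T T.injective).2 hw₁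
  obtain ⟨X, hX⟩ := exists_comp_eq_of_range_le (f := σ ∘ₗ smulRightₗ.flip w₁)
    (smulRightₗ_flip_injective (V := V) hTw₁) (by
      rintro _ ⟨φ, rfl⟩
      obtain ⟨φ', hφ'⟩ := hT φ
      exact ⟨φ', (hφ' w₁).symm⟩)
  have hXT : ∀ φ w, σ (smulRightₗ φ w) = smulRightₗ (X φ) (T w) := by
    intro φ w
    obtain ⟨φ', hφ'⟩ := hT φ
    rw [hφ', smulRightₗ_flip_injective hTw₁ ((hφ' w₁).symm.trans (LinearMap.congr_fun hX φ).symm)]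
  have hXinj : Function.Injective X := by
    have hinj : Function.Injective (σ ∘ₗ smulRightₗ.flip w₁ : Dual K V →ₗ[K] V →ₗ[K] W) :=
      hσ.comp (smulRightₗ_flip_injective hw₁)
    rw [← hX, coe_comp] at hinj
    exact hinj.of_comp
  obtain ⟨g, hg⟩ := exists_linearEquiv_of_injective_dual hXinj
  have heq : σ = T.toLinearMap.compRight K ∘ₗ lcomp K W g.toLinearMap :=
    eq_of_forall_smulRightₗ_eq fun φ w => LinearMap.ext fun v => by
      rw [hXT]
      simp [hg]
  exact ⟨g, T, LinearMap.congr_fun heq⟩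
end RankPreserver

section ProductAut

open LinearMap Module

variable {K V V' : Type*} [Field K] [AddCommGroup V] [Module K V] [AddCommGroup V'] [Module K V']
  {θ : K ≃+* K} {g : V ≃+ V} {g' : V' ≃+ V'}

/-- The bilinear form `(v, v') ↦ θ (f (g v, g' v'))`. -/
def pullbackForm (hg : ∀ (c : K) (v : V), g (c • v) = θ.symm c • g v)
    (hg' : ∀ (c : K) (v' : V'), g' (c • v') = θ.symm c • g' v') (f : V →ₗ[K] V' →ₗ[K] K) :
    V →ₗ[K] V' →ₗ[K] K :=
  LinearMap.mk₂ K (fun v v' => θ (f (g v) (g' v'))) (fun v w v' => by simp)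
    (fun c v v' => by simp [hg]) (fun v v' w' => by simp) (fun c v v' => by simp [hg'])

theorem symm_smul_of_smul (hg : ∀ (c : K) (v : V), g (c • v) = θ.symm c • g v) (c : K) (v : V) :
    g.symm (c • v) = θ c • g.symm v := by
  rw [AddEquiv.symm_apply_eq, hg, θ.symm_apply_apply, g.apply_symm_apply]

/-- The transformation `f ↦ ((v, v') ↦ θ (f (g v, g' v')))` of the space of bilinear forms. -/
def productAut (hg : ∀ (c : K) (v : V), g (c • v) = θ.symm c • g v)
    (hg' : ∀ (c : K) (v' : V'), g' (c • v') = θ.symm c • g' v') :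
    (V →ₗ[K] V' →ₗ[K] K) ≃+ (V →ₗ[K] V' →ₗ[K] K) where
  toFun := pullbackForm hg hg'
  invFun := pullbackForm (θ := θ.symm) (symm_smul_of_smul hg) (symm_smul_of_smul hg')
  left_inv f := by ext; simp [pullbackForm]
  right_inv f := by ext; simp [pullbackForm]
  map_add' f f' := by ext; simp [pullbackForm]

theorem productAut_apply (hg : ∀ (c : K) (v : V), g (c • v) = θ.symm c • g v)
    (hg' : ∀ (c : K) (v' : V'), g' (c • v') = θ.symm c • g' v') (f : V →ₗ[K] V' →ₗ[K] K) (v : V)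
    (v' : V') : productAut hg hg' f v v' = θ (f (g v) (g' v')) := rfl

theorem isProductAut_productAut (hg : ∀ (c : K) (v : V), g (c • v) = θ.symm c • g v)
    (hg' : ∀ (c : K) (v' : V'), g' (c • v') = θ.symm c • g' v') :
    IsProductAut (productAut hg hg') :=
  ⟨θ, g, g', hg, hg', productAut_apply hg hg'⟩

variable {τ : (V →ₗ[K] V' →ₗ[K] K) ≃+ (V →ₗ[K] V' →ₗ[K] K)}

theorem finrank_ker_eq_of_semilinear (hg : ∀ (c : K) (v : V), g (c • v) = θ.symm c • g v)
    {f f' : V →ₗ[K] V'} (h : ∀ v, f' v = 0 ↔ f (g v) = 0) :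
    finrank K (ker f') = finrank K (ker f) := by
  let e : ker f' ≃+ ker f :=
    { g.toEquiv.subtypeEquiv h with map_add' := fun v w => Subtype.ext (map_add g v.1 w.1) }
  exact congrArg Cardinal.toNat
    (rank_eq_of_equiv_equiv θ.symm e θ.symm.bijective fun c v => Subtype.ext (hg c v))

theorem IsProductAut.isRankAut (h : IsProductAut τ) : IsRankAut τ := by
  obtain ⟨θ, g, g', hg, -, hτ⟩ := h
  refine ⟨⟨θ, fun c f => by ext; simp [hτ]⟩, fun f => ?_⟩
  rw [formRank, formRank, finrank_ker_eq_of_semilinear hg fun v => ?_]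
  rw [LinearMap.ext_iff, LinearMap.ext_iff, ← g'.forall_congr_right (q := fun v' => f (g v) v' = _)]
  simp [hτ]

theorem exists_semilinear_addEquiv (θ : K ≃+* K) :
    ∃ g : V ≃+ V, ∀ (c : K) (v : V), g (c • v) = θ c • g v := by
  let b := Basis.ofVectorSpace K V
  refine ⟨b.repr.toAddEquiv.trans
    ((Finsupp.mapRange.addEquiv θ.toAddEquiv).trans b.repr.symm.toAddEquiv), fun c v => ?_⟩
  refine b.repr.injective (Finsupp.ext fun i => ?_)
  simp

theorem formRank_le_one_iff [FiniteDimensional K V] {f : V →ₗ[K] V' →ₗ[K] K} :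
    formRank f ≤ 1 ↔ ∃ φ ψ, f = smulRightₗ φ ψ := by
  rw [← finrank_range_le_one_iff, formRank, ← f.finrank_range_add_finrank_ker, Nat.add_sub_cancel]

variable [FiniteDimensional K V] [FiniteDimensional K V']

theorem exists_linear_of_rank_preserving {σ : (V →ₗ[K] V' →ₗ[K] K) →ₗ[K] V →ₗ[K] V' →ₗ[K] K}
    (hσ : Function.Injective σ) (hrank : ∀ f, formRank (σ f) = formRank f)
    (hdim : finrank K V < finrank K V') :
    ∃ (g : V ≃ₗ[K] V) (g' : V' ≃ₗ[K] V'), ∀ f v v', σ f v v' = f (g v) (g' v') := by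
  obtain ⟨g, T, hσT⟩ := exists_eq_comp_comp_of_rank_one_preserver hσ
    (fun φ ψ => formRank_le_one_iff.1 ((hrank _).trans_le (formRank_le_one_iff.2 ⟨φ, ψ, rfl⟩)))
    (by rwa [Subspace.dual_finrank_eq])
  obtain ⟨g', hg'⟩ := exists_linearEquiv_of_injective_dual (X := T.toLinearMap) T.injective
  exact ⟨g, g', fun f v v' => by rw [hg', hσT]; rfl⟩

theorem IsRankAut.isProductAut (hdim : finrank K V < finrank K V') (h : IsRankAut τ) :
    IsProductAut τ := by
  obtain ⟨⟨θ, hθ⟩, hrank⟩ := h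
  obtain ⟨g₀, hg₀⟩ := exists_semilinear_addEquiv (V := V) θ.symm
  obtain ⟨g₀', hg₀'⟩ := exists_semilinear_addEquiv (V := V') θ.symm
  let ρ := productAut hg₀ hg₀'
  have hρ : ∀ f v v', ρ f v v' = θ (f (g₀ v) (g₀' v')) := productAut_apply hg₀ hg₀'
  have hρsmul : ∀ c f, ρ (c • f) = θ c • ρ f := fun c f => by ext; simp [hρ]
  let σ : (V →ₗ[K] V' →ₗ[K] K) →ₗ[K] V →ₗ[K] V' →ₗ[K] K :=
    { (τ.trans ρ.symm).toAddMonoidHom with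
      map_smul' := fun c f => ρ.symm_apply_eq.2 <| by
        simp [hθ, hρsmul] }
  have hρσ : ∀ f, ρ (σ f) = τ f := fun f => ρ.apply_symm_apply _
  have hσrank : ∀ f, formRank (σ f) = formRank f := fun f => by
    rw [← hrank f, ← hρσ, (isProductAut_productAut hg₀ hg₀').isRankAut.2]
  obtain ⟨g, g', hσ⟩ := exists_linear_of_rank_preserving
    (σ := σ) (τ.trans ρ.symm).injective hσrank hdim
  refine ⟨θ, g₀.trans g.toAddEquiv, g₀'.trans g'.toAddEquiv, fun c v => ?_, fun c v' => ?_,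
    fun f v v' => ?_⟩
  · simp [hg₀]
  · simp [hg₀']
  · rw [← hρσ, hρ, hσ]
    rfl

theorem codeEquiv_iff_productEquiv (hdim : finrank K V < finrank K V')
    {X₁ X₂ : Set (V →ₗ[K] V' →ₗ[K] K)} : CodeEquiv X₁ X₂ ↔ ProductEquiv X₁ X₂ :=
  exists_congr fun _ => and_congr_left' ⟨fun h => h.isProductAut hdim, fun h => h.isRankAut⟩

end ProductAut

section Twist

variable {K L : Type*} [Field K] [Fintype K] [Field L] [Finite L] [Algebra K L]

theorem frobPow_add (y z : ℤ) (x : L) : frobPow K (y + z) x = frobPow K y (frobPow K z x) := by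
  simp only [frobPow, zpow_add, AlgEquiv.mul_apply]

theorem frobPow_zero (x : L) : frobPow K 0 x = x := by
  simp only [frobPow, zpow_zero, AlgEquiv.one_apply]

theorem frobPow_eq_frobPow_iff {y z : ℤ} :
    (frobPow K y : L ≃ₐ[K] L) = frobPow K z ↔ y ≡ z [ZMOD Module.finrank K L] := by
  rw [frobPow, frobPow, zpow_eq_zpow_iff_modEq, FiniteField.orderOf_frobeniusAlgEquivOfAlgebraic]

theorem frobPow_algebraMap {F : Type*} [Field F] [Finite F] [Algebra K F] [Algebra F L]
    (z : ℤ) (x : F) :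
    frobPow K z (algebraMap F L x) = algebraMap F L (frobPow K z x) := by
  have hnat (w : ℕ) (x : F) :
      frobPow K (w : ℤ) (algebraMap F L x) = algebraMap F L (frobPow K (w : ℤ) x) := by
    rw [frobPow_natCast, frobPow_natCast, map_pow]
  obtain ⟨w, rfl | rfl⟩ := z.eq_nat_or_neg
  · exact hnat w x
  · apply (frobPow K (w : ℤ) : L ≃ₐ[K] L).injective
    rw [hnat, ← frobPow_add, ← frobPow_add, add_neg_cancel, frobPow_zero, frobPow_zero]

variable (K) in
/-- The automorphism `x ↦ x ^ (q ^ (κ z))` of `L` over `K`, written `x^{(z)}` below. The exponent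
`z` is a residue class modulo `n`, which is meaningful when `n` is the degree of `L` over `K`. -/
def twist (κ : ℤ) {n : ℕ} (z : ZMod n) : L ≃ₐ[K] L := frobPow K (κ * (z.cast : ℤ))

variable {n : ℕ} {κ : ℤ}

theorem twist_intCast (hn : Module.finrank K L = n) (z : ℤ) :
    (twist K κ (z : ZMod n) : L ≃ₐ[K] L) = frobPow K (κ * z) := by
  rw [twist, frobPow_eq_frobPow_iff, hn]
  refine Int.ModEq.mul_left _ ?_
  rw [← ZMod.intCast_eq_intCast_iff, ZMod.intCast_zmod_cast]

theorem twist_zero (x : L) : twist K κ (0 : ZMod n) x = x := by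
  rw [twist, ZMod.cast_zero, mul_zero, frobPow_zero]

theorem twist_add (hn : Module.finrank K L = n) (y z : ZMod n) (x : L) :
    twist K κ (y + z) x = twist K κ y (twist K κ z x) := by
  obtain ⟨y, rfl⟩ := ZMod.intCast_surjective y
  obtain ⟨z, rfl⟩ := ZMod.intCast_surjective z
  rw [← Int.cast_add, twist_intCast hn, twist_intCast hn, twist_intCast hn, mul_add, frobPow_add]

theorem twist_neg_apply_twist (hn : Module.finrank K L = n) (z : ZMod n) (x : L) :
    twist K κ (-z) (twist K κ z x) = x := by
  rw [← twist_add hn, neg_add_cancel, twist_zero]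

theorem twist_apply_twist_neg (hn : Module.finrank K L = n) (z : ZMod n) (x : L) :
    twist K κ z (twist K κ (-z) x) = x := by
  rw [← twist_add hn, add_neg_cancel, twist_zero]

theorem twist_injective (hn : Module.finrank K L = n) (hκ : IsCoprime κ n) :
    Function.Injective (twist K κ : ZMod n → L ≃ₐ[K] L) := by
  intro y z h
  obtain ⟨y, rfl⟩ := ZMod.intCast_surjective y
  obtain ⟨z, rfl⟩ := ZMod.intCast_surjective z
  rw [twist_intCast hn, twist_intCast hn, frobPow_eq_frobPow_iff, hn, Int.modEq_iff_dvd,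
    ← mul_sub] at h
  rw [ZMod.intCast_eq_intCast_iff, Int.modEq_iff_dvd]
  exact hκ.symm.dvd_of_dvd_mul_left h

theorem twist_algebraMap {F : Type*} [Field F] [Finite F] [Algebra K F] [Algebra F L]
    {m : ℕ} (hm : Module.finrank K F = m) (hn : Module.finrank K L = n)
    (hmn : m ∣ n) (z : ZMod n) (x : F) :
    twist K κ z (algebraMap F L x) =
      algebraMap F L (twist K κ (ZMod.castHom hmn (ZMod m) z) x) := by
  obtain ⟨z, rfl⟩ := ZMod.intCast_surjective z
  rw [map_intCast, twist_intCast hn, twist_intCast hm, frobPow_algebraMap]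

theorem trace_mul_twist (hn : Module.finrank K L = n) (z : ZMod n) (x y : L) :
    Algebra.trace K L (x * twist K κ z y) = Algebra.trace K L (y * twist K κ (-z) x) := by
  rw [← Algebra.trace_eq_of_algEquiv (twist K κ (-z)), map_mul, twist_neg_apply_twist hn, mul_comm]

end Twist

section LinPoly

open Module

variable {K F L : Type*} [Field K] [Fintype K] [Field F] [Finite F] [Field L]
  [Algebra K F] [Algebra K L] [Algebra F L] [IsScalarTower K F L] {m n : ℕ} {κ : ℤ} [NeZero m]

variable (K F) in
/-- The map `x ↦ ∑ c_i x^{(i)}` from `F` to `L` given by a linearized polynomial with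
coefficients `c_i`, where `i` runs through the residue classes modulo `m`. -/
def linPoly (κ : ℤ) : (ZMod m → L) →ₗ[L] F →ₗ[K] L :=
  Fintype.linearCombination L fun i =>
    ((IsScalarTower.toAlgHom K F L).comp (twist K κ i : F ≃ₐ[K] F).toAlgHom).toLinearMap

theorem linPoly_apply (c : ZMod m → L) (x : F) :
    linPoly K F κ c x = ∑ i, c i * algebraMap F L (twist K κ i x) := by
  simp [linPoly, Fintype.linearCombination_apply, LinearMap.sum_apply]

theorem linPoly_self_apply [Finite L] (c : ZMod m → L) (x : L) :
    linPoly K L κ c x = ∑ i, c i * twist K κ i x := linPoly_apply c x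

theorem linPoly_injective (hm : finrank K F = m) (hκ : IsCoprime κ m) :
    Function.Injective (linPoly K F κ : (ZMod m → L) → F →ₗ[K] L) := by
  let e : ZMod m → F →* L := fun i => (algebraMap F L : F →* L).comp (twist K κ i : F ≃ₐ[K] F)
  have he : Function.Injective e := fun i j hij =>
    twist_injective hm hκ (AlgEquiv.ext fun x =>
      (algebraMap F L).injective (DFunLike.congr_fun hij x))
  have hli := (linearIndependent_monoidHom F L).comp e he
  rw [Fintype.linearIndependent_iff] at hli
  refine (injective_iff_map_eq_zero _).2 fun c hc => funext <| hli c <| funext fun x => ?_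
  have hx := LinearMap.congr_fun hc x
  rw [linPoly_apply] at hx
  simpa [e] using hx

theorem linPoly_surjective (hm : finrank K F = m) (hκ : IsCoprime κ m) :
    Function.Surjective (linPoly K F κ : (ZMod m → L) → F →ₗ[K] L) := by
  have hfin : FiniteDimensional K F := Module.Finite.of_finite
  refine (LinearMap.injective_iff_surjective_of_finrank_eq_finrank ?_).1 (linPoly_injective hm hκ)
  rw [finrank_fintype_fun_eq_card, ZMod.card, Module.finrank_linearMap_self, hm]

theorem linPoly_single (i : ZMod m) (c : L) (x : F) :
    linPoly K F κ (Pi.single i c) x = c * algebraMap F L (twist K κ i x) := by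
  rw [linPoly_apply, Finset.sum_eq_single_of_mem i (Finset.mem_univ i), Pi.single_eq_same]
  intro j _ hj
  rw [Pi.single_eq_of_ne hj, zero_mul]

theorem injective_linPoly_single {i : ZMod m} {c : L} (hc : c ≠ 0) :
    Function.Injective (linPoly K F κ (Pi.single i c)) := by
  have h : ⇑(linPoly K F κ (Pi.single i c)) = (c * ·) ∘ algebraMap F L ∘ twist K κ i :=
    funext (linPoly_single i c)
  rw [h]
  exact (mul_right_injective₀ hc).comp
    ((algebraMap F L).injective.comp (twist K κ i).injective)

end LinPoly

section Comp

open Module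

variable {K M N : Type*} [Field K] [Fintype K] [Field M] [Finite M] [Field N] [Algebra K M]
  [Algebra M N] {m n : ℕ} {κ : ℤ} [NeZero n]

variable (K) in
/-- The coefficients of the composition of the linearized polynomials with coefficients `b` and
`c`, see `linPoly_comp`. -/
def linComp (κ : ℤ) (hmn : m ∣ n) (b : ZMod n → N) (c : ZMod m → M) : ZMod m → N := fun d =>
  ∑ l, b l * algebraMap M N (twist K κ l (c (d - ZMod.castHom hmn (ZMod m) l)))

theorem linComp_single_left (hmn : m ∣ n) (j : ZMod n) (γ : N) (c : ZMod m → M) (d : ZMod m) :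
    linComp K κ hmn (Pi.single j γ) c d =
      γ * algebraMap M N (twist K κ j (c (d - ZMod.castHom hmn (ZMod m) j))) := by
  rw [linComp, Finset.sum_eq_single_of_mem j (Finset.mem_univ j), Pi.single_eq_same]
  intro l _ hl
  rw [Pi.single_eq_of_ne hl, zero_mul]

theorem linComp_add_left (hmn : m ∣ n) (b b' : ZMod n → N) (c : ZMod m → M) :
    linComp K κ hmn (b + b') c = linComp K κ hmn b c + linComp K κ hmn b' c := by
  ext d
  simp only [linComp, Pi.add_apply, add_mul, Finset.sum_add_distrib]

theorem linComp_add_right (hmn : m ∣ n) (b : ZMod n → N) (c c' : ZMod m → M) :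
    linComp K κ hmn b (c + c') = linComp K κ hmn b c + linComp K κ hmn b c' := by
  ext d
  simp only [linComp, Pi.add_apply, map_add, mul_add, Finset.sum_add_distrib]

variable {F : Type*} [Field F] [Finite F] [Algebra K F] [Algebra K N] [Algebra F M] [Algebra F N]
  [IsScalarTower K F M] [IsScalarTower K M N] [IsScalarTower K F N] [IsScalarTower F M N] [NeZero m]

theorem linPoly_comp (hm : finrank K F = m) (hn : finrank K M = n) (hmn : m ∣ n) (b : ZMod n → N)
    (c : ZMod m → M) :
    linPoly K M κ b ∘ₗ linPoly K F κ c = linPoly K F κ (linComp K κ hmn b c) := by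
  ext x
  calc linPoly K M κ b (linPoly K F κ c x)
      = ∑ l, ∑ i, b l * algebraMap M N (twist K κ l (c i)) *
          algebraMap F N (twist K κ (ZMod.castHom hmn (ZMod m) l + i) x) := by
        simp only [linPoly_apply, map_sum, map_mul, mul_assoc, twist_algebraMap hm hn hmn,
          ← twist_add hm, ← IsScalarTower.algebraMap_apply F M N]
        exact Finset.sum_comm
    _ = ∑ l, ∑ d, b l * algebraMap M N (twist K κ l (c (d - ZMod.castHom hmn (ZMod m) l))) *
          algebraMap F N (twist K κ d x) := by
        refine Finset.sum_congr rfl fun l _ => ?_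
        refine Fintype.sum_equiv (Equiv.addLeft (ZMod.castHom hmn (ZMod m) l)) _ _ fun i => ?_
        simp only [Equiv.coe_addLeft, add_sub_cancel_left]
    _ = linPoly K F κ (linComp K κ hmn b c) x := by
        rw [Finset.sum_comm, linPoly_apply]
        simp only [linComp, Finset.sum_mul]

end Comp

section Forms

open Module

variable {K F L : Type*} [Field K] [Fintype K] [Field F] [Finite F] [Field L] [Algebra K F]
  [Algebra K L] [Algebra F L] [IsScalarTower K F L] {m n : ℕ} {κ : ℤ} [NeZero m] [NeZero n]

variable (K F) in
/-- The bilinear form `(x, y) ↦ Tr((∑ c_i x^{(i)}) y)` on `F × L`. -/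
def coeffForm (κ : ℤ) : (ZMod m → L) →ₗ[K] F →ₗ[K] L →ₗ[K] K :=
  LinearMap.compRight K (Algebra.traceForm K L : L →ₗ[K] L →ₗ[K] K) ∘ₗ
    (linPoly K F κ).restrictScalars K

theorem coeffForm_apply (c : ZMod m → L) (x : F) (y : L) :
    coeffForm K F κ c x y = Algebra.trace K L (linPoly K F κ c x * y) := rfl

variable [Finite L]

theorem coeffForm_injective (hm : finrank K F = m) (hκ : IsCoprime κ m) :
    Function.Injective (coeffForm K F κ : (ZMod m → L) → F →ₗ[K] L →ₗ[K] K) := by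
  intro c d h
  refine linPoly_injective hm hκ (LinearMap.ext fun x => sub_eq_zero.1 ?_)
  refine (traceForm_nondegenerate K L).1 _ fun y => ?_
  rw [map_sub, LinearMap.sub_apply, sub_eq_zero]
  exact LinearMap.congr_fun₂ h x y

variable (K) in
/-- The coefficients of the adjoint, with respect to the trace form, of a linearized polynomial;
see `trace_linPoly_mul`. -/
def adjCoeff (κ : ℤ) (g : ZMod n → L) : ZMod n → L := fun l => twist K κ l (g (-l))

theorem trace_linPoly_mul (hn : finrank K L = n) (g : ZMod n → L) (y z : L) :
    Algebra.trace K L (linPoly K L κ g y * z) =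
      Algebra.trace K L (y * linPoly K L κ (adjCoeff K κ g) z) := by
  simp only [linPoly_self_apply, Finset.sum_mul, Finset.mul_sum, map_sum]
  refine Fintype.sum_equiv (Equiv.neg _) _ _ fun l => ?_
  rw [mul_right_comm, trace_mul_twist hn, map_mul (twist K κ (-l)), adjCoeff, Equiv.neg_apply,
    neg_neg]

theorem coeffForm_comp (hm : finrank K F = m) (hn : finrank K L = n) (hmn : m ∣ n)
    (c : ZMod m → L) (a : ZMod m → F) (g : ZMod n → L) (x : F) (y : L) :
    coeffForm K F κ c (linPoly K F κ a x) (linPoly K L κ g y) =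
      coeffForm K F κ (linComp K κ hmn (adjCoeff K κ g) (linComp K κ dvd_rfl c a)) x y := by
  rw [coeffForm_apply, coeffForm_apply, mul_comm, trace_linPoly_mul hn, mul_comm,
    ← linPoly_comp hm hn, ← linPoly_comp hm hm]
  rfl

end Forms

section ResidueClasses

theorem natCast_ne_zero_of_lt {m j : ℕ} (hj : 1 ≤ j) (hjm : j < m) : (j : ZMod m) ≠ 0 := by
  rw [Ne, ZMod.natCast_eq_zero_iff]
  exact Nat.not_dvd_of_pos_of_lt hj hjm

theorem sum_zmod_eq_sum_range {M : Type*} [AddCommMonoid M] {m : ℕ} [NeZero m] (g : ZMod m → M) :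
    ∑ i, g i = ∑ j ∈ Finset.range m, g (j : ZMod m) := by
  refine Finset.sum_nbij' (fun i => i.val) (fun j => (j : ZMod m)) ?_ ?_ ?_ ?_ ?_
  · exact fun i _ => Finset.mem_range.2 (ZMod.val_lt i)
  · exact fun j _ => Finset.mem_univ _
  · exact fun i _ => ZMod.natCast_zmod_val i
  · exact fun j hj => ZMod.val_cast_of_lt (Finset.mem_range.1 hj)
  · exact fun i _ => by rw [ZMod.natCast_zmod_val]

end ResidueClasses

section TwistedCoeff

open Module

variable {K F L : Type*} [Field K] [Fintype K] [Field F] [Finite F] [Field L] [Finite L]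
  [Algebra K F] [Algebra K L] [Algebra F L] [IsScalarTower K F L] {m n : ℕ} {κ : ℤ}

variable (K m) in
/-- The coefficients `c` of the linearized polynomials in a twisted Gabidulin code: those with
`c_i = 0` for `i > t` and `c_t = (μ c_0^{(-s)})^{(t)}`. -/
def twistedCoeff (κ : ℤ) (t : ℕ) (μ : L) (s : ZMod n) : Submodule K (ZMod m → L) where
  carrier := {c | (∀ i, t < i.val → c i = 0) ∧
    c t = twist K κ (t : ZMod n) (μ * twist K κ (-s) (c 0))}
  add_mem' := by
    rintro c d ⟨hc, hct⟩ ⟨hd, hdt⟩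
    refine ⟨fun i hi => ?_, ?_⟩
    · rw [Pi.add_apply, hc i hi, hd i hi, add_zero]
    · rw [Pi.add_apply, Pi.add_apply, hct, hdt, map_add, mul_add, map_add]
  zero_mem' := by simp
  smul_mem' := by
    rintro x c ⟨hc, hct⟩
    refine ⟨fun i hi => ?_, ?_⟩
    · rw [Pi.smul_apply, hc i hi, smul_zero]
    · rw [Pi.smul_apply, Pi.smul_apply, hct, map_smul, mul_smul_comm, map_smul]

theorem mem_twistedCoeff_iff {t : ℕ} {μ : L} {s : ZMod n} {c : ZMod m → L} :
    c ∈ twistedCoeff K m κ t μ s ↔ (∀ i, t < i.val → c i = 0) ∧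
      c t = twist K κ (t : ZMod n) (μ * twist K κ (-s) (c 0)) := Iff.rfl

variable (K m) in
/-- The linearized polynomial with coefficient `γ` at `0` and the coefficient at `t` which this
forces in a twisted Gabidulin code. -/
def twistedPair (κ : ℤ) (t : ℕ) (μ : L) (s : ZMod n) : L →ₗ[K] ZMod m → L :=
  LinearMap.single K (fun _ => L) 0 + LinearMap.single K (fun _ => L) (t : ZMod m) ∘ₗ
    (twist K κ (t : ZMod n) : L ≃ₐ[K] L).toLinearMap ∘ₗ LinearMap.mulLeft K μ ∘ₗ
      (twist K κ (-s) : L ≃ₐ[K] L).toLinearMap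

theorem twistedPair_apply (t : ℕ) (μ : L) (s : ZMod n) (γ : L) :
    twistedPair K m κ t μ s γ =
      Pi.single 0 γ + Pi.single (t : ZMod m) (twist K κ (t : ZMod n) (μ * twist K κ (-s) γ)) := rfl

section Membership

variable {t : ℕ} {μ : L} {s : ZMod n}

theorem single_mem_twistedCoeff (htm : t < m) {j : ℕ} (hj : 1 ≤ j) (hjt : j < t) (γ : L) :
    Pi.single (j : ZMod m) γ ∈ twistedCoeff K m κ t μ s := by
  have hj0 := natCast_ne_zero_of_lt hj (hjt.trans htm)
  have hval : (j : ZMod m).val = j := ZMod.val_cast_of_lt (hjt.trans htm)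
  refine mem_twistedCoeff_iff.2 ⟨fun i hi => Pi.single_eq_of_ne ?_ _, ?_⟩
  · rintro rfl
    omega
  · rw [Pi.single_eq_of_ne hj0.symm, map_zero, mul_zero, map_zero, Pi.single_eq_of_ne]
    intro h
    have := congrArg ZMod.val h
    rw [hval, ZMod.val_cast_of_lt htm] at this
    omega

theorem twistedPair_mem_twistedCoeff (ht : 1 ≤ t) (htm : t < m) (γ : L) :
    twistedPair K m κ t μ s γ ∈ twistedCoeff K m κ t μ s := by
  have ht0 := natCast_ne_zero_of_lt ht htm
  refine mem_twistedCoeff_iff.2 ⟨fun i hi => ?_, ?_⟩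
  · have hi0 : i ≠ 0 := by
      rintro rfl
      rw [ZMod.val_zero] at hi
      omega
    have hit : i ≠ t := by
      rintro rfl
      rw [ZMod.val_cast_of_lt htm] at hi
      omega
    rw [twistedPair_apply, Pi.add_apply, Pi.single_eq_of_ne hi0, Pi.single_eq_of_ne hit, add_zero]
  · rw [twistedPair_apply, Pi.add_apply, Pi.add_apply, Pi.single_eq_same, Pi.single_eq_same,
      Pi.single_eq_of_ne ht0, Pi.single_eq_of_ne ht0.symm, zero_add, add_zero]

theorem eq_twistedPair_add_sum [NeZero m] (ht : 1 ≤ t) (htm : t < m) {c : ZMod m → L}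
    (hc : c ∈ twistedCoeff K m κ t μ s) :
    c = twistedPair K m κ t μ s (c 0) +
      ∑ j ∈ Finset.Icc 1 (t - 1), Pi.single (j : ZMod m) (c j) := by
  obtain ⟨hvan, hct⟩ := hc
  rw [twistedPair_apply, ← hct]
  calc c = ∑ j ∈ Finset.range m, Pi.single (j : ZMod m) (c j) := by
        rw [← sum_zmod_eq_sum_range fun i => Pi.single i (c i), Finset.univ_sum_single]
    _ = ∑ j ∈ insert 0 (insert t (Finset.Icc 1 (t - 1))), Pi.single (j : ZMod m) (c j) := by
        symm
        refine Finset.sum_subset (fun j => ?_) fun j hj hjt => ?_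
        · simp only [Finset.mem_insert, Finset.mem_Icc, Finset.mem_range]
          omega
        · simp only [Finset.mem_insert, Finset.mem_Icc, Finset.mem_range] at hj hjt
          rw [hvan _ (by rw [ZMod.val_cast_of_lt hj]; omega), Pi.single_zero]
    _ = _ := by
        rw [Finset.sum_insert, Finset.sum_insert, ← add_assoc, Nat.cast_zero]
        all_goals simp only [Finset.mem_insert, Finset.mem_Icc]; omega

theorem twistedCoeff_eq_sup [NeZero m] (ht : 1 ≤ t) (htm : t < m) :
    twistedCoeff K m κ t μ s = LinearMap.range (twistedPair K m κ t μ s) ⊔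
      ⨆ j ∈ Finset.Icc 1 (t - 1),
        LinearMap.range (LinearMap.single K (fun _ => L) (j : ZMod m)) := by
  apply le_antisymm
  · intro c hc
    rw [eq_twistedPair_add_sum ht htm hc]
    exact Submodule.add_mem_sup ⟨_, rfl⟩ <| Submodule.sum_mem _ fun j hj =>
      Submodule.mem_iSup_of_mem j (Submodule.mem_iSup_of_mem hj ⟨_, rfl⟩)
  · refine sup_le ?_ (iSup₂_le fun j hj => ?_)
    · rintro _ ⟨γ, rfl⟩
      exact twistedPair_mem_twistedCoeff ht htm γ
    · rintro _ ⟨γ, rfl⟩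
      rw [Finset.mem_Icc] at hj
      exact single_mem_twistedCoeff htm hj.1 (by omega) γ

theorem ncard_twistedCoeff_le [NeZero m] (ht : 1 ≤ t) (htm : t < m) (μ ν : L) (s u : ZMod n) :
    (twistedCoeff K m κ t μ s : Set (ZMod m → L)).ncard ≤
      (twistedCoeff K m κ t ν u : Set (ZMod m → L)).ncard := by
  have ht0 : (0 : ZMod m) ≠ t := (natCast_ne_zero_of_lt ht htm).symm
  refine Set.ncard_le_ncard_of_injOn (fun c => Function.update c (t : ZMod m)
    (twist K κ (t : ZMod n) (ν * twist K κ (-u) (c 0)))) ?_ ?_ (Set.toFinite _)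
  · refine fun c hc => mem_twistedCoeff_iff.2 ⟨fun i hi => ?_, ?_⟩
    · have hit : i ≠ t := by
        rintro rfl
        rw [ZMod.val_cast_of_lt htm] at hi
        omega
      rw [Function.update_of_ne hit, hc.1 i hi]
    · rw [Function.update_self, Function.update_of_ne ht0]
  · intro c hc d hd h
    have hne : ∀ i, i ≠ (t : ZMod m) → c i = d i := fun i hi => by
      simpa only [Function.update_of_ne hi] using congrFun h i
    funext i
    by_cases hi : i = t
    · rw [hi, hc.2, hd.2, hne 0 ht0]
    · exact hne i hi

end Membership

theorem puncture_cyclicForm [NeZero m] (hm : finrank K F = m) (hn : finrank K L = n) (hmn : m ∣ n)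
    (k j : ℕ) (a : L) :
    puncture K F L (cyclicForm K L k j a) =
      coeffForm K F (-k) (Pi.single (j : ZMod m) (twist K (-k) (j : ZMod n) a)) := by
  ext x y
  have hfrob : (frobPow K ((k * j : ℕ) : ℤ) : L ≃ₐ[K] L) = twist K (-k) (-(j : ZMod n)) := by
    rw [← Int.cast_natCast j, ← Int.cast_neg, twist_intCast hn, Nat.cast_mul, neg_mul_neg]
  rw [puncture_apply, cyclicForm_apply, coeffForm_apply, linPoly_single, hfrob, trace_mul_twist hn,
    neg_neg, map_mul (twist K (-(k : ℤ)) (j : ZMod n)), twist_algebraMap hm hn hmn, map_natCast,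
    mul_comm]

theorem map_puncture_component [NeZero m] (hm : finrank K F = m) (hn : finrank K L = n)
    (hmn : m ∣ n) (k j : ℕ) :
    (component K L k j).map (puncture K F L) =
      (LinearMap.range (LinearMap.single K (fun _ => L) (j : ZMod m))).map
        (coeffForm K F (-k)) := by
  rw [component, ← LinearMap.range_comp, ← LinearMap.range_comp]
  have hj : LinearMap.range (twist K (-k) (j : ZMod n) : L ≃ₐ[K] L).toLinearMap = ⊤ :=
    LinearMap.range_eq_top.2 (twist K (-k) (j : ZMod n) : L ≃ₐ[K] L).surjective
  rw [← LinearMap.range_comp_of_range_eq_top (coeffForm K F (-k) ∘ₗ _) hj]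
  congr 1
  ext1 a
  exact puncture_cyclicForm hm hn hmn k j a

theorem map_puncture_twistedPart [NeZero m] (hm : finrank K F = m) (hn : finrank K L = n)
    (hmn : m ∣ n) (k t : ℕ) (μ : L) (s : ℤ) :
    (twistedPart K L k t μ s).map (puncture K F L) =
      (LinearMap.range (twistedPair K m (-k) t μ (s : ZMod n))).map (coeffForm K F (-k)) := by
  rw [twistedPart, ← LinearMap.range_comp, ← LinearMap.range_comp]
  congr 1
  ext1 a
  have hfrob : (frobPow K (s * k) : L ≃ₐ[K] L) = twist K (-k) (-(s : ZMod n)) := by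
    rw [← Int.cast_neg, twist_intCast hn, neg_mul_neg, mul_comm]
  simp only [LinearMap.comp_apply, LinearMap.coe_mk, AddHom.coe_mk, map_add, hfrob,
    puncture_cyclicForm hm hn hmn, twistedPair_apply, Nat.cast_zero, twist_zero]

theorem puncturedTwistedGabidulin_eq_map [NeZero m] (hm : finrank K F = m) (hn : finrank K L = n)
    (hmn : m ∣ n) (k : ℕ) {t : ℕ} (ht : 1 ≤ t) (htm : t < m) (μ : L) (s : ℤ) :
    puncturedTwistedGabidulin K F L k t μ s =
      (twistedCoeff K m (-k) t μ (s : ZMod n)).map (coeffForm K F (-k)) := by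
  simp only [puncturedTwistedGabidulin, twistedGabidulin, twistedCoeff_eq_sup ht htm,
    Submodule.map_sup, Submodule.map_iSup, map_puncture_twistedPart hm hn hmn,
    map_puncture_component hm hn hmn]

end TwistedCoeff

section Support

variable {m : ℕ} [NeZero m] {A B : Set (ZMod m)} {t : ℕ} {σ : ZMod m}

theorem val_neg_one_eq : (-1 : ZMod m).val = m - 1 := by
  obtain ⟨m, rfl⟩ := Nat.exists_eq_succ_of_ne_zero (NeZero.ne m)
  exact ZMod.val_neg_one m

theorem add_eq_zero_or_one_or_neg_one (ht : 2 ≤ t) (htm : t + 2 ≤ m)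
    (hmid : ∀ j : ℕ, 1 ≤ j → j < t → ∀ i ∈ A, ∀ l ∈ B, (i + l + j).val ≤ t) {i l : ZMod m}
    (hi : i ∈ A) (hl : l ∈ B) : i + l = 0 ∨ i + l = 1 ∨ i + l = -1 := by
  by_contra! hD
  have hmid' (j : ℕ) (hj : 1 ≤ j) (hjt : j < t) (hjm : (i + l).val + j < m) :
      (i + l).val + j ≤ t := by
    have h := hmid j hj hjt i hi l hl
    rwa [← ZMod.natCast_zmod_val (i + l), ← Nat.cast_add, ZMod.val_cast_of_lt hjm] at h
  have h0 : (i + l).val ≠ 0 := (ZMod.val_ne_zero _).2 hD.1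
  have h1 : (i + l).val ≠ 1 := fun h => hD.2.1 (by
    rw [← ZMod.natCast_zmod_val (i + l), h, Nat.cast_one])
  have h2 : (i + l).val ≠ m - 1 := fun h => hD.2.2 (ZMod.val_injective m (by
    rw [h, val_neg_one_eq]))
  have hlt := ZMod.val_lt (i + l)
  by_cases htv : t ≤ (i + l).val
  · have := hmid' 1 le_rfl (by omega) (by omega)
    omega
  · have := hmid' (t + 1 - (i + l).val) (by omega) (by omega) (by omega)
    omega

theorem add_eq_zero_of_two_le (ht : 2 ≤ t) (htm : t + 2 ≤ m)
    (hmid : ∀ j : ℕ, 1 ≤ j → j < t → ∀ i ∈ A, ∀ l ∈ B, (i + l + j).val ≤ t)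
    (hsub : ∀ i ∈ A, ∀ l ∈ B, t < (i + l).val → i - σ ∈ A)
    (hadd : ∀ i ∈ A, ∀ l ∈ B, t < (i + l + t).val → i + σ ∈ A)
    (h0 : σ ≠ 0) (h1 : σ ≠ -1) (h2 : σ ≠ -2) {i l : ZMod m} (hi : i ∈ A) (hl : l ∈ B) :
    i + l = 0 := by
  have key {i l : ZMod m} (hi : i ∈ A) (hl : l ∈ B) : i + l = 0 ∨ i + l = 1 ∨ i + l = -1 :=
    add_eq_zero_or_one_or_neg_one ht htm hmid hi hl
  obtain h | h | h := key hi hl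
  · exact h
  · have hval : (1 + t : ZMod m).val = t + 1 := by
      rw [← Nat.cast_one, ← Nat.cast_add, ZMod.val_cast_of_lt (by omega), add_comm]
    have hiσ := hadd i hi l hl (by rw [h, hval]; omega)
    obtain h' | h' | h' := key hiσ hl
    · exact absurd (by linear_combination h' - h) h1
    · exact absurd (by linear_combination h' - h) h0
    · exact absurd (by linear_combination h' - h) h2
  · have hiσ := hsub i hi l hl (by rw [h, val_neg_one_eq]; omega)
    obtain h' | h' | h' := key hiσ hl
    · exact absurd (by linear_combination h - h') h1
    · exact absurd (by linear_combination h - h') h2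
    · exact absurd (by linear_combination h - h') h0

theorem natCast_mem_of_mem {S : Set (ZMod m)} (hpred : ∀ D ∈ S, 1 < D.val → D - 1 ∈ S)
    (hsucc : ∀ D ∈ S, 1 < (D + 1).val → D + 1 ∈ S) {D : ZMod m} (hD : D ∈ S) (hD0 : D ≠ 0) {w : ℕ}
    (hw : 1 ≤ w) (hwm : w < m) : (w : ZMod m) ∈ S := by
  have hone : ∀ v : ℕ, 1 ≤ v → v < m → (v : ZMod m) ∈ S → ((1 : ℕ) : ZMod m) ∈ S := by
    intro v hv
    induction v, hv using Nat.le_induction with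
    | base => exact fun _ h => h
    | succ v hv ih =>
      intro hvm hvS
      have := hpred _ hvS (by rw [ZMod.val_cast_of_lt hvm]; omega)
      exact ih (by omega) (by rwa [Nat.cast_succ, add_sub_cancel_right] at this)
  induction w, hw using Nat.le_induction with
  | base =>
    exact hone D.val (Nat.one_le_iff_ne_zero.2 ((ZMod.val_ne_zero _).2 hD0)) D.val_lt
      (by rwa [ZMod.natCast_zmod_val])
  | succ w hw ih =>
    have := hsucc _ (ih (by omega)) (by rw [← Nat.cast_succ, ZMod.val_cast_of_lt hwm]; omega)
    rwa [Nat.cast_succ]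

theorem exists_mem_sub_mem (hsub : ∀ i ∈ A, ∀ l ∈ B, 1 < (i + l).val → i - σ ∈ A ∧ l + σ - 1 ∈ B)
    (hadd : ∀ i ∈ A, ∀ l ∈ B, 1 < (i + l + 1).val → i + σ ∈ A ∧ l - σ + 1 ∈ B) {i l : ZMod m}
    (hi : i ∈ A) (hl : l ∈ B) (hil : i + l ≠ 0) {w : ℕ} (hw : 1 ≤ w) (hwm : w < m) :
    ∃ l ∈ B, (w : ZMod m) - l ∈ A := by
  let S : Set (ZMod m) := {D | ∃ l ∈ B, D - l ∈ A}
  have hpred : ∀ D ∈ S, 1 < D.val → D - 1 ∈ S := by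
    rintro D ⟨l, hl, hDl⟩ hD
    obtain ⟨hA, hB⟩ := hsub _ hDl l hl (by rwa [sub_add_cancel])
    exact ⟨_, hB, by convert hA using 1; ring⟩
  have hsucc : ∀ D ∈ S, 1 < (D + 1).val → D + 1 ∈ S := by
    rintro D ⟨l, hl, hDl⟩ hD
    obtain ⟨hA, hB⟩ := hadd _ hDl l hl (by rwa [sub_add_cancel])
    exact ⟨_, hB, by convert hA using 1; ring⟩
  exact natCast_mem_of_mem hpred hsucc ⟨l, hl, by rwa [add_sub_cancel_right]⟩ hil hw hwm

end Support

section Composition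

open Module

variable {K F L : Type*} [Field K] [Fintype K] [Field F] [Finite F] [Field L] [Finite L]
  [Algebra K F] [Algebra K L] [Algebra F L] {m n : ℕ} {κ : ℤ} [NeZero m] [NeZero n]

theorem linComp_linComp_single (hmn : m ∣ n) (b : ZMod n → L) (j : ZMod m) (γ : L) (a : ZMod m → F)
    (d : ZMod m) :
    linComp K κ hmn b (linComp K κ dvd_rfl (Pi.single j γ) a) d =
      linPoly K L κ (fun l => b l * twist K κ l (algebraMap F L
        (twist K κ j (a (d - ZMod.castHom hmn (ZMod m) l - j))))) γ := by
  rw [linPoly_self_apply, linComp]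
  refine Finset.sum_congr rfl fun l _ => ?_
  rw [linComp_single_left, ZMod.castHom_self, RingHom.id_apply, Algebra.algebraMap_self_apply,
    map_mul (twist K κ l), mul_comm (twist K κ l γ), mul_assoc]

variable (K) in
/-- The coefficient of `γ^{(l)}` in the coefficient of `x^{(d)}` in `B(C(A(x)))`, where `A`, `B`
and `C` are the linearized polynomials with coefficients `a`, `b` and `twistedPair K m κ t μ s γ`;
see `linComp_linComp_twistedPair`. -/
def pairCoeff (κ : ℤ) (hmn : m ∣ n) (a : ZMod m → F) (b : ZMod n → L) (t : ℕ) (μ : L) (s : ZMod n)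
    (d : ZMod m) (l : ZMod n) : L :=
  b l * twist K κ l (algebraMap F L (a (d - ZMod.castHom hmn (ZMod m) l))) +
    b (l + s - t) * twist K κ (l + s) (μ * algebraMap F L
      (a (d - ZMod.castHom hmn (ZMod m) (l + s))))

theorem linComp_linComp_twistedPair (hm : finrank K F = m) (hn : finrank K L = n) (hmn : m ∣ n)
    (b : ZMod n → L) (t : ℕ) (μ : L) (s : ZMod n) (γ : L) (a : ZMod m → F) (d : ZMod m) :
    linComp K κ hmn b (linComp K κ dvd_rfl (twistedPair K m κ t μ s γ) a) d =
      linPoly K L κ (pairCoeff K κ hmn a b t μ s d) γ := by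
  rw [twistedPair_apply, linComp_add_left, linComp_add_right, Pi.add_apply, linComp_linComp_single,
    linComp_linComp_single, linPoly_self_apply, linPoly_self_apply, linPoly_self_apply]
  simp only [pairCoeff, add_mul, Finset.sum_add_distrib, sub_zero, twist_zero]
  congr 1
  refine Fintype.sum_equiv (Equiv.addRight (t - s : ZMod n)) _ _ fun l => ?_
  have hl : l + (t - s) + s = l + t := by ring
  have hbar : ZMod.castHom hmn (ZMod m) (l + t) = ZMod.castHom hmn (ZMod m) l + t := by
    rw [map_add, map_natCast]
  have hιt (x : F) : algebraMap F L (twist K κ (t : ZMod m) x) =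
      twist K κ (t : ZMod n) (algebraMap F L x) := by
    rw [twist_algebraMap hm hn hmn, map_natCast]
  simp only [Equiv.coe_addRight]
  rw [hl, add_sub_cancel_right, hbar, hιt, ← twist_add hn l, ← twist_add hn l,
    map_mul, map_mul, ← sub_sub, ← add_sub_assoc, sub_eq_add_neg (l + _), twist_add hn _ (-s)]
  ring

end Composition

section CodeMaps

open Module

variable {K F L : Type*} [Field K] [Fintype K] [Field F] [Finite F] [Field L] [Finite L]
  [Algebra K F] [Algebra K L] [Algebra F L] {m n : ℕ} {κ : ℤ}
  [NeZero m] {hmn : m ∣ n} {a : ZMod m → F} {b : ZMod n → L} {t : ℕ} {μ ν : L}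
  {s u : ZMod n}

theorem not_forall_eq_mul_twist (hm : finrank K F = m)
    (hn : finrank K L = n) (hκ : IsCoprime κ m) (ha : Function.Surjective (linPoly K F κ a))
    (hs : ZMod.castHom hmn (ZMod m) s ≠ 0) (c : L) :
    ¬ ∀ i, algebraMap F L (a i) =
      c * twist K κ s (algebraMap F L (a (i - ZMod.castHom hmn (ZMod m) s))) := by
  intro h
  have hιA (x : F) : algebraMap F L (linPoly K F κ a x) =
      c * twist K κ s (algebraMap F L (linPoly K F κ a x)) := by
    simp only [linPoly_self_apply, map_sum, map_mul, Finset.mul_sum]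
    symm
    refine Fintype.sum_equiv (Equiv.addRight (ZMod.castHom hmn (ZMod m) s)) _ _ fun i => ?_
    simp only [Equiv.coe_addRight]
    rw [h (i + _), add_sub_cancel_right, add_comm i, twist_add hm,
      ← twist_algebraMap hm hn hmn, mul_assoc]
  have hι (y : F) : algebraMap F L y = c * twist K κ s (algebraMap F L y) := by
    obtain ⟨x, rfl⟩ := ha y
    exact hιA x
  have hc : c = 1 := by simpa using (hι 1).symm
  refine hs (twist_injective hm hκ (AlgEquiv.ext fun y => (algebraMap F L).injective ?_))
  rw [← twist_algebraMap hm hn hmn, twist_zero]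
  simpa only [hc, one_mul] using (hι y).symm

variable [NeZero n]

variable (K) in
/-- Composition with the linearized polynomials with coefficients `a` on the right and `b` on the
left maps the twisted Gabidulin code with parameters `μ, s` into the one with parameters `ν, u`. -/
def CompMapsTo (κ : ℤ) (hmn : m ∣ n) (a : ZMod m → F) (b : ZMod n → L) (t : ℕ) (μ : L)
    (s : ZMod n) (ν : L) (u : ZMod n) : Prop :=
  ∀ c ∈ twistedCoeff K m κ t μ s,
    linComp K κ hmn b (linComp K κ dvd_rfl c a) ∈ twistedCoeff K m κ t ν u

theorem CompMapsTo.eq_zero_or_eq_zero (h : CompMapsTo K κ hmn a b t μ s ν u)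
    (hn : finrank K L = n) (hκ : IsCoprime κ n) (htm : t < m) {j : ℕ} (hj : 1 ≤ j) (hjt : j < t)
    {d : ZMod m} (hd : t < d.val) (l : ZMod n) :
    b l = 0 ∨ a (d - ZMod.castHom hmn (ZMod m) l - j) = 0 := by
  have hpoly : linPoly K L κ (fun l => b l * twist K κ l (algebraMap F L
      (twist K κ (j : ZMod m) (a (d - ZMod.castHom hmn (ZMod m) l - j))))) = 0 := by
    ext γ
    rw [← linComp_linComp_single hmn b (j : ZMod m) γ a d]
    exact (h _ (single_mem_twistedCoeff htm hj hjt γ)).1 d hd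
  have hl := congrFun ((map_eq_zero_iff _ (linPoly_injective hn hκ)).1 hpoly) l
  simpa only [Pi.zero_apply, mul_eq_zero, EmbeddingLike.map_eq_zero_iff, map_eq_zero] using hl

theorem CompMapsTo.pairCoeff_eq_zero (h : CompMapsTo K κ hmn a b t μ s ν u)
    (hm : finrank K F = m) (hn : finrank K L = n) (hκ : IsCoprime κ n) (ht : 1 ≤ t) (htm : t < m)
    {d : ZMod m} (hd : t < d.val) (l : ZMod n) : pairCoeff K κ hmn a b t μ s d l = 0 := by
  have hpoly : linPoly K L κ (pairCoeff K κ hmn a b t μ s d) = 0 := by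
    ext γ
    rw [← linComp_linComp_twistedPair hm hn hmn]
    exact (h _ (twistedPair_mem_twistedCoeff ht htm γ)).1 d hd
  exact congrFun ((map_eq_zero_iff _ (linPoly_injective hn hκ)).1 hpoly) l

theorem CompMapsTo.ne_zero_and_ne_zero_iff (h : CompMapsTo K κ hmn a b t μ s ν u)
    (hm : finrank K F = m) (hn : finrank K L = n) (hκ : IsCoprime κ n) (ht : 1 ≤ t) (htm : t < m)
    (hμ : μ ≠ 0) {d : ZMod m} (hd : t < d.val) (l : ZMod n) :
    b l ≠ 0 ∧ a (d - ZMod.castHom hmn (ZMod m) l) ≠ 0 ↔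
      b (l + s - t) ≠ 0 ∧ a (d - ZMod.castHom hmn (ZMod m) (l + s)) ≠ 0 := by
  have h0 := eq_neg_of_add_eq_zero_left (h.pairCoeff_eq_zero hm hn hκ ht htm hd l)
  simpa [hμ] using (congrArg (· ≠ 0) h0).to_iff

theorem CompMapsTo.sub_ne_zero_and_ne_zero (h : CompMapsTo K κ hmn a b t μ s ν u)
    (hm : finrank K F = m) (hn : finrank K L = n) (hκ : IsCoprime κ n) (ht : 1 ≤ t) (htm : t < m)
    (hμ : μ ≠ 0) {i : ZMod m} {l : ZMod n} (hi : a i ≠ 0) (hl : b l ≠ 0)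
    (hd : t < (i + ZMod.castHom hmn (ZMod m) l).val) :
    a (i - ZMod.castHom hmn (ZMod m) s) ≠ 0 ∧ b (l + s - t) ≠ 0 := by
  have h0 := h.ne_zero_and_ne_zero_iff hm hn hκ ht htm hμ hd l
  rw [add_sub_cancel_right, map_add, sub_add_eq_sub_sub, add_sub_cancel_right] at h0
  exact (h0.1 ⟨hl, hi⟩).symm

theorem CompMapsTo.add_ne_zero_and_ne_zero (h : CompMapsTo K κ hmn a b t μ s ν u)
    (hm : finrank K F = m) (hn : finrank K L = n) (hκ : IsCoprime κ n) (ht : 1 ≤ t) (htm : t < m)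
    (hμ : μ ≠ 0) {i : ZMod m} {l : ZMod n} (hi : a i ≠ 0) (hl : b l ≠ 0)
    (hd : t < (i + ZMod.castHom hmn (ZMod m) l + t).val) :
    a (i + ZMod.castHom hmn (ZMod m) s) ≠ 0 ∧ b (l - s + t) ≠ 0 := by
  have h0 := h.ne_zero_and_ne_zero_iff hm hn hκ ht htm hμ hd (l - s + t)
  have hb : l - s + t + s - t = l := by ring
  have hi' : i + ZMod.castHom hmn (ZMod m) l + t -
      ZMod.castHom hmn (ZMod m) (l - s + t + s) = i := by
    simp only [map_add, map_sub, map_natCast]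
    ring
  have hiσ : i + ZMod.castHom hmn (ZMod m) l + t - ZMod.castHom hmn (ZMod m) (l - s + t) =
      i + ZMod.castHom hmn (ZMod m) s := by
    simp only [map_add, map_sub, map_natCast]
    ring
  rw [hb, hi', hiσ] at h0
  exact (h0.2 ⟨hl, hi⟩).symm

theorem CompMapsTo.exists_eq_mul_twist (h : CompMapsTo K κ hmn a b t μ s ν u)
    (hm : finrank K F = m) (hn : finrank K L = n) (hκ : IsCoprime κ n) (ht : 1 ≤ t) (htm : t < m)
    {l : ZMod n} (hl : b l ≠ 0) :
    ∃ c, ∀ i, t < (i + ZMod.castHom hmn (ZMod m) l).val →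
      algebraMap F L (a i) =
        c * twist K κ s (algebraMap F L (a (i - ZMod.castHom hmn (ZMod m) s))) := by
  refine ⟨twist K κ (-l) (-b (l + s - t) / b l) * twist K κ s μ, fun i hd => ?_⟩
  have h0 := h.pairCoeff_eq_zero hm hn hκ ht htm hd l
  rw [pairCoeff, add_sub_cancel_right, map_add, sub_add_eq_sub_sub, add_sub_cancel_right,
    twist_add hn] at h0
  apply (twist K κ l : L ≃ₐ[K] L).injective
  rw [map_mul, map_mul, twist_apply_twist_neg hn, div_mul_eq_mul_div, div_mul_eq_mul_div,
    eq_div_iff hl, mul_comm, eq_neg_of_add_eq_zero_left h0, map_mul (twist K κ s), map_mul]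
  ring

theorem CompMapsTo.add_eq_zero_of_two_le (h : CompMapsTo K κ hmn a b t μ s ν u)
    (hm : finrank K F = m) (hn : finrank K L = n) (hκ : IsCoprime κ n) (ht : 2 ≤ t)
    (htm : t + 2 ≤ m) (hμ : μ ≠ 0) (h0 : ZMod.castHom hmn (ZMod m) s ≠ 0)
    (h1 : ZMod.castHom hmn (ZMod m) s ≠ -1) (h2 : ZMod.castHom hmn (ZMod m) s ≠ -2)
    {i : ZMod m} {l : ZMod n} (hi : a i ≠ 0) (hl : b l ≠ 0) :
    i + ZMod.castHom hmn (ZMod m) l = 0 := by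
  refine PuncturedCodes.add_eq_zero_of_two_le (A := {i | a i ≠ 0})
    (B := ZMod.castHom hmn (ZMod m) '' {l | b l ≠ 0}) ht htm ?_ ?_ ?_ h0 h1 h2 hi ⟨l, hl, rfl⟩
  · rintro j hj hjt i hi _ ⟨l, hl, rfl⟩
    by_contra! hd
    refine (h.eq_zero_or_eq_zero hn hκ (by omega) hj hjt hd l).elim hl fun h' => hi ?_
    rwa [add_right_comm, add_sub_cancel_right, add_sub_cancel_right] at h'
  · rintro i hi _ ⟨l, hl, rfl⟩ hd
    exact (h.sub_ne_zero_and_ne_zero hm hn hκ (by omega) (by omega) hμ hi hl hd).1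
  · rintro i hi _ ⟨l, hl, rfl⟩ hd
    exact (h.add_ne_zero_and_ne_zero hm hn hκ (by omega) (by omega) hμ hi hl hd).1

theorem CompMapsTo.exists_ne_zero_and_sub_ne_zero (h : CompMapsTo K κ hmn a b 1 μ s ν u)
    (hm : finrank K F = m) (hn : finrank K L = n) (hκ : IsCoprime κ n) (hμ : μ ≠ 0)
    {i : ZMod m} {l : ZMod n} (hi : a i ≠ 0) (hl : b l ≠ 0)
    (hil : i + ZMod.castHom hmn (ZMod m) l ≠ 0) {w : ℕ} (hw : 1 ≤ w) (hwm : w < m) :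
    ∃ l, b l ≠ 0 ∧ a (w - ZMod.castHom hmn (ZMod m) l) ≠ 0 := by
  have hstep : ∃ l' ∈ ZMod.castHom hmn (ZMod m) '' {l | b l ≠ 0}, a (w - l') ≠ 0 := by
    refine exists_mem_sub_mem (A := {i | a i ≠ 0}) (σ := ZMod.castHom hmn (ZMod m) s) ?_ ?_ hi
      (Set.mem_image_of_mem _ hl) hil hw hwm
    · rintro i hi _ ⟨l, hl, rfl⟩ hd
      obtain ⟨hiσ, hlσ⟩ := h.sub_ne_zero_and_ne_zero hm hn hκ le_rfl (by omega) hμ hi hl hd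
      exact ⟨hiσ, _, hlσ, by rw [map_sub, map_add, map_natCast, Nat.cast_one]⟩
    · rintro i hi _ ⟨l, hl, rfl⟩ hd
      obtain ⟨hiσ, hlσ⟩ := h.add_ne_zero_and_ne_zero hm hn hκ le_rfl (by omega) hμ hi hl
        (by rwa [Nat.cast_one])
      exact ⟨hiσ, _, hlσ, by rw [map_add, map_sub, map_natCast, Nat.cast_one]⟩
  obtain ⟨_, ⟨l', hl', rfl⟩, hi'⟩ := hstep
  exact ⟨l', hl', hi'⟩

theorem eq_zero_or_eq_one_of_val_le_one {x : ZMod m} (hx : x.val ≤ 1) : x = 0 ∨ x = 1 := by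
  obtain h | h := Nat.le_one_iff_eq_zero_or_eq_one.1 hx
  · exact Or.inl ((ZMod.val_eq_zero x).1 h)
  · exact Or.inr (by rw [← ZMod.natCast_zmod_val x, h, Nat.cast_one])

-- A nonzero `b l` gives the recursion for `i` with `i + l ∉ {0, 1}`, and a nonzero `b (l + s - 1)`
-- gives it for `i` with `i + l + s - 1 ∉ {0, 1}`. As `s ≠ 0, 1, 2`, no `i` is left out. Since
-- `s ≠ -1, -2`, the index `i = 3 - l` satisfies both conditions, so the constants agree.
theorem CompMapsTo.exists_forall_eq_mul_twist (h : CompMapsTo K κ hmn a b 1 μ s ν u)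
    (hm : finrank K F = m) (hn : finrank K L = n) (hκ : IsCoprime κ n) (hm4 : 3 < m) (hμ : μ ≠ 0)
    (h0 : ZMod.castHom hmn (ZMod m) s ≠ 0) (h1 : ZMod.castHom hmn (ZMod m) s ≠ 1)
    (h1' : ZMod.castHom hmn (ZMod m) s ≠ -1) (h2 : ZMod.castHom hmn (ZMod m) s ≠ 2)
    (h2' : ZMod.castHom hmn (ZMod m) s ≠ -2) {l : ZMod n} (hl : b l ≠ 0)
    (hi : a (3 - ZMod.castHom hmn (ZMod m) l) ≠ 0) :
    ∃ c, ∀ i, algebraMap F L (a i) =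
      c * twist K κ s (algebraMap F L (a (i - ZMod.castHom hmn (ZMod m) s))) := by
  have hm1 : 1 < m := by omega
  have h3 : 1 < (3 - ZMod.castHom hmn (ZMod m) l + ZMod.castHom hmn (ZMod m) l).val := by
    rw [sub_add_cancel, ZMod.val_ofNat_of_lt hm4]
    exact Nat.one_lt_ofNat
  obtain ⟨-, hlσ⟩ := h.sub_ne_zero_and_ne_zero hm hn hκ le_rfl hm1 hμ hi hl h3
  obtain ⟨c, hc⟩ := h.exists_eq_mul_twist hm hn hκ le_rfl hm1 hl
  obtain ⟨c', hc'⟩ := h.exists_eq_mul_twist hm hn hκ le_rfl hm1 hlσ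
  simp only [map_add, map_sub, Nat.cast_one, map_one] at hc'
  have hcc' : c = c' := by
    have e := hc _ h3
    refine mul_right_cancel₀ (right_ne_zero_of_mul (e ▸ (map_ne_zero _).2 hi)) (e.symm.trans ?_)
    refine hc' _ (not_le.1 fun hle => ?_)
    obtain e' | e' := eq_zero_or_eq_one_of_val_le_one hle
    · exact h2' (by linear_combination e')
    · exact h1' (by linear_combination e')
  refine ⟨c, fun i => (lt_or_ge 1 _).elim (hc i) fun hle => ?_⟩
  rw [hcc']
  refine hc' i (not_le.1 fun hle' => ?_)
  obtain e | e := eq_zero_or_eq_one_of_val_le_one hle <;>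
    obtain e' | e' := eq_zero_or_eq_one_of_val_le_one hle'
  · exact h1 (by linear_combination e' - e)
  · exact h2 (by linear_combination e' - e)
  · exact h0 (by linear_combination e' - e)
  · exact h1 (by linear_combination e' - e)

theorem CompMapsTo.add_eq_zero (h : CompMapsTo K κ hmn a b t μ s ν u)
    (hm : finrank K F = m) (hn : finrank K L = n) (hκ : IsCoprime κ n) (ht : 1 ≤ t)
    (htm : t + 2 ≤ m) (hμ : μ ≠ 0)
    (h0 : ZMod.castHom hmn (ZMod m) s ≠ 0) (h1 : ZMod.castHom hmn (ZMod m) s ≠ 1)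
    (h1' : ZMod.castHom hmn (ZMod m) s ≠ -1) (h2 : ZMod.castHom hmn (ZMod m) s ≠ 2)
    (h2' : ZMod.castHom hmn (ZMod m) s ≠ -2) (ha : Function.Surjective (linPoly K F κ a))
    {i : ZMod m} {l : ZMod n} (hi : a i ≠ 0) (hl : b l ≠ 0) :
    i + ZMod.castHom hmn (ZMod m) l = 0 := by
  obtain ht2 | rfl := ht.lt_or_eq
  · exact h.add_eq_zero_of_two_le hm hn hκ ht2 htm hμ h0 h1' h2' hi hl
  by_contra hil
  have hm4 : 3 < m := by
    by_contra! hle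
    obtain rfl : m = 3 := by omega
    revert h0 h1 h1'
    generalize ZMod.castHom hmn (ZMod 3) s = σ
    decide +revert
  obtain ⟨l', hl', hi'⟩ := h.exists_ne_zero_and_sub_ne_zero hm hn hκ hμ hi hl hil (w := 3)
    (by omega) hm4
  obtain ⟨c, hc⟩ := h.exists_forall_eq_mul_twist hm hn hκ hm4 hμ h0 h1 h1' h2 h2' hl' hi'
  exact not_forall_eq_mul_twist (hmn := hmn) hm hn
    (hκ.of_isCoprime_of_dvd_right (Int.natCast_dvd_natCast.2 hmn)) ha h0 c hc

end CodeMaps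

section Monomial

open Module

variable {K F L : Type*} [Field K] [Fintype K] [Field F] [Field L] [Finite L] [Algebra K L]
  [Algebra F L] {m n : ℕ} {κ : ℤ} {hmn : m ∣ n} {a : ZMod m → F} {b : ZMod n → L} {t : ℕ}
  {μ ν : L} {s u : ZMod n}

theorem castHom_eq_castHom_of_forall_eq {i : ZMod m} {α : L} (hα : α ≠ 0) (hμ : μ ≠ 0)
    (hb0 : b ≠ 0) (hb : ∀ l, b l ≠ 0 → ZMod.castHom hmn (ZMod m) l = -i)
    (h : ∀ z, twist K κ (-t : ZMod n) (b (z + s)) * twist K κ (z + s) (μ * α) =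
      ν * twist K κ (-u) (b (z + u)) * twist K κ z α) :
    ZMod.castHom hmn (ZMod m) s = ZMod.castHom hmn (ZMod m) u := by
  obtain ⟨l, hl⟩ := Function.ne_iff.1 hb0
  have hlu : b (l - s + u) ≠ 0 := by
    intro h0
    have hz := h (l - s)
    rw [h0, map_zero, mul_zero, zero_mul, sub_add_cancel] at hz
    simp_all only [mul_eq_zero, EmbeddingLike.map_eq_zero_iff, or_self, Pi.zero_apply, ne_eq]
  have e := (hb _ hlu).trans (hb _ hl).symm
  rw [map_add, map_sub] at e
  linear_combination -e

variable [Finite F] [Algebra K F] [NeZero m] [NeZero n]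

theorem linComp_linComp_single_right {i : ZMod m} {a₀ : F}
    (hb : ∀ l, b l ≠ 0 → ZMod.castHom hmn (ZMod m) l = -i) (c : ZMod m → L) (d : ZMod m) :
    linComp K κ hmn b (linComp K κ dvd_rfl c (Pi.single i a₀)) d =
      linPoly K L κ b (c d * algebraMap F L (twist K κ d a₀)) := by
  have hc (e : ZMod m) : linComp K κ dvd_rfl c (Pi.single i a₀) e =
      c (e - i) * algebraMap F L (twist K κ (e - i) a₀) := by
    rw [linComp, Finset.sum_eq_single_of_mem (e - i) (Finset.mem_univ _)]
    · rw [ZMod.castHom_self, RingHom.id_apply, sub_sub_cancel, Pi.single_eq_same]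
    · intro l _ hl
      rw [ZMod.castHom_self, RingHom.id_apply, Pi.single_eq_of_ne, map_zero, map_zero, mul_zero]
      rintro rfl
      exact hl (sub_sub_cancel e l).symm
  rw [linComp, linPoly_self_apply]
  refine Finset.sum_congr rfl fun l _ => ?_
  by_cases hl : b l = 0
  · rw [hl, zero_mul, zero_mul]
  · rw [hc, hb l hl, sub_neg_eq_add, add_sub_cancel_right, Algebra.algebraMap_self_apply]

theorem CompMapsTo.exists_eq_single (h : CompMapsTo K κ hmn a b t μ s ν u)
    (hm : finrank K F = m) (hn : finrank K L = n) (hκ : IsCoprime κ n) (ht : 1 ≤ t)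
    (htm : t + 2 ≤ m) (hμ : μ ≠ 0)
    (h0 : ZMod.castHom hmn (ZMod m) s ≠ 0) (h1 : ZMod.castHom hmn (ZMod m) s ≠ 1)
    (h1' : ZMod.castHom hmn (ZMod m) s ≠ -1) (h2 : ZMod.castHom hmn (ZMod m) s ≠ 2)
    (h2' : ZMod.castHom hmn (ZMod m) s ≠ -2) (ha : Function.Surjective (linPoly K F κ a))
    (hb : b ≠ 0) :
    ∃ i a₀, a₀ ≠ 0 ∧ a = Pi.single i a₀ ∧
      ∀ l, b l ≠ 0 → ZMod.castHom hmn (ZMod m) l = -i := by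
  have hadd {i l} (hi : a i ≠ 0) (hl : b l ≠ 0) : i + ZMod.castHom hmn (ZMod m) l = 0 :=
    h.add_eq_zero hm hn hκ ht htm hμ h0 h1 h1' h2 h2' ha hi hl
  have ha0 : a ≠ 0 := by
    rintro rfl
    obtain ⟨x, hx⟩ := ha 1
    simp at hx
  obtain ⟨i, hi⟩ := Function.ne_iff.1 ha0
  obtain ⟨l₀, hl₀⟩ := Function.ne_iff.1 hb
  refine ⟨i, a i, hi, ?_, fun l hl => eq_neg_of_add_eq_zero_right (hadd hi hl)⟩
  ext i'
  by_cases hii' : i' = i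
  · rw [hii', Pi.single_eq_same]
  · rw [Pi.single_eq_of_ne hii']
    by_contra hi'
    exact hii' (add_right_cancel ((hadd hi' hl₀).trans (hadd hi hl₀).symm))

theorem compMapsTo_single_iff_linPoly {i : ZMod m} {a₀ : F}
    (hm : finrank K F = m) (hn : finrank K L = n) (ht : 1 ≤ t) (htm : t < m)
    (hb : ∀ l, b l ≠ 0 → ZMod.castHom hmn (ZMod m) l = -i) :
    CompMapsTo K κ hmn (Pi.single i a₀) b t μ s ν u ↔
      ∀ γ, linPoly K L κ b (twist K κ (t : ZMod n) (μ * twist K κ (-s) γ * algebraMap F L a₀)) =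
        twist K κ (t : ZMod n) (ν * twist K κ (-u) (linPoly K L κ b (γ * algebraMap F L a₀))) := by
  have hιt : algebraMap F L (twist K κ (t : ZMod m) a₀) =
      twist K κ (t : ZMod n) (algebraMap F L a₀) := by
    rw [twist_algebraMap hm hn hmn, map_natCast]
  simp only [CompMapsTo, mem_twistedCoeff_iff, linComp_linComp_single_right hb, twist_zero, hιt]
  constructor
  · intro h γ
    have hγ := twistedPair_mem_twistedCoeff (K := K) (κ := κ) (μ := μ) (s := s) ht htm γ
    have hγ0 : twistedPair K m κ t μ s γ 0 = γ := by
      rw [twistedPair_apply, Pi.add_apply, Pi.single_eq_same,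
        Pi.single_eq_of_ne (natCast_ne_zero_of_lt ht htm).symm, add_zero]
    simpa only [hγ.2, hγ0, ← map_mul] using (h _ hγ).2
  · rintro h c ⟨hvan, hct⟩
    refine ⟨fun d hd => by rw [hvan d hd, zero_mul, map_zero], ?_⟩
    rw [hct, ← map_mul, h]

theorem compMapsTo_single_iff {i : ZMod m} {a₀ : F}
    (hm : finrank K F = m) (hn : finrank K L = n) (hκ : IsCoprime κ n) (ht : 1 ≤ t) (htm : t < m)
    (hb : ∀ l, b l ≠ 0 → ZMod.castHom hmn (ZMod m) l = -i) :
    CompMapsTo K κ hmn (Pi.single i a₀) b t μ s ν u ↔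
      ∀ z, twist K κ (-t : ZMod n) (b (z + s)) * twist K κ (z + s) (μ * algebraMap F L a₀) =
        ν * twist K κ (-u) (b (z + u)) * twist K κ z (algebraMap F L a₀) := by
  have hleft (γ : L) :
      linPoly K L κ b (twist K κ (t : ZMod n) (μ * twist K κ (-s) γ * algebraMap F L a₀)) =
        twist K κ (t : ZMod n) (linPoly K L κ (fun z => twist K κ (-t : ZMod n) (b (z + s)) *
          twist K κ (z + s) (μ * algebraMap F L a₀)) γ) := by
    simp only [linPoly_self_apply, map_sum]
    refine Fintype.sum_equiv (Equiv.subRight s) _ _ fun y => ?_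
    have hcomm (x : L) : twist K κ y (twist K κ (t : ZMod n) x) =
        twist K κ (t : ZMod n) (twist K κ y x) := by
      rw [← twist_add hn, ← twist_add hn, add_comm]
    rw [Equiv.subRight_apply, sub_add_cancel, sub_eq_add_neg, twist_add hn y]
    simp only [map_mul, hcomm, twist_apply_twist_neg hn]
    ring
  have hright (γ : L) :
      ν * twist K κ (-u) (linPoly K L κ b (γ * algebraMap F L a₀)) =
        linPoly K L κ (fun z => ν * twist K κ (-u) (b (z + u)) *
          twist K κ z (algebraMap F L a₀)) γ := by
    simp only [linPoly_self_apply, map_sum, Finset.mul_sum]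
    refine Fintype.sum_equiv (Equiv.subRight u) _ _ fun l => ?_
    simp only [Equiv.subRight_apply, sub_add_cancel, map_mul, ← twist_add hn, neg_add_eq_sub]
    ring
  simp only [compMapsTo_single_iff_linPoly hm hn ht htm hb, hleft, hright,
    EmbeddingLike.apply_eq_iff_eq]
  rw [← LinearMap.ext_iff, (linPoly_injective hn hκ).eq_iff, funext_iff]

end Monomial

section PowerMaps

open Module

theorem charP_of_algebra (p : ℕ) (K L : Type*) [Field K] [CharP K p] [Field L] [Algebra K L] :
    CharP L p :=
  charP_of_injective_algebraMap (algebraMap K L).injective p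

variable (p : ℕ) [Fact p.Prime] {K F L : Type*} [Field K] [CharP K p] [Field L] [Algebra K L]

theorem exists_ringEquiv_eq_pow [Finite K] (θ : K ≃+* K) : ∃ e : ℕ, ∀ c, θ c = c ^ p ^ e := by
  let _ : Algebra (ZMod p) K := ZMod.algebra K p
  let θ' : K ≃ₐ[ZMod p] K := AlgEquiv.ofRingEquiv (f := θ) fun r =>
    RingHom.congr_fun (Subsingleton.elim ((θ : K →+* K).comp (algebraMap (ZMod p) K)) _) r
  obtain ⟨e, he⟩ := (FiniteField.bijective_frobeniusAlgEquivOfAlgebraic_pow (ZMod p) K).2 θ'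
  have hθ : θ' = frobPow (ZMod p) (e : ℕ) := by rw [← he, frobPow, zpow_natCast]
  refine ⟨e, fun c => ?_⟩
  have h := frobPow_natCast (K := ZMod p) e c
  rw [ZMod.card, ← hθ] at h
  exact h

theorem trace_pow_char_pow [Finite L] (e : ℕ) (z : L) :
    Algebra.trace K L (z ^ p ^ e) = Algebra.trace K L z ^ p ^ e := by
  have hK : Finite K := Finite.of_injective _ (algebraMap K L).injective
  have := charP_of_algebra p K L
  have h := Algebra.trace_eq_of_equiv_equiv (iterateFrobeniusEquiv K p e)
    (iterateFrobeniusEquiv L p e) (by ext x; simp [iterateFrobenius_def]) z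
  rw [RingEquiv.eq_symm_apply] at h
  simpa only [iterateFrobeniusEquiv_def] using h.symm

section Semilinear

variable {M : Type*} [Field M] [Algebra K M]

theorem exists_linearMap_eq_pow {θ : K ≃+* K} {e : ℕ} (hθ : ∀ c, θ c = c ^ p ^ e) {g : M ≃+ M}
    (hg : ∀ (c : K) v, g (c • v) = θ.symm c • g v) :
    ∃ A : M →ₗ[K] M, Function.Injective A ∧ ∀ x, A x = g x ^ p ^ e := by
  have := charP_of_algebra p K M
  let A : M →ₗ[K] M :=
    { toFun := fun x => g x ^ p ^ e
      map_add' := fun x y => by rw [map_add, add_pow_char_pow]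
      map_smul' := fun c x => by
        rw [hg, smul_pow, ← hθ, θ.apply_symm_apply, RingHom.id_apply] }
  exact ⟨A, (iterateFrobenius_inj M p e).comp g.injective, fun x => rfl⟩

theorem exists_addEquiv_pow_eq [Finite K] [Finite M] (e : ℕ) {A : M →ₗ[K] M}
    (hA : Function.Injective A) :
    ∃ g : M ≃+ M, (∀ (c : K) v, g (c • v) = (iterateFrobeniusEquiv K p e).symm c • g v) ∧
      ∀ x, A x = g x ^ p ^ e := by
  have := charP_of_algebra p K M
  let g : M ≃+ M := (AddEquiv.ofBijective A ⟨hA, Finite.injective_iff_surjective.1 hA⟩).trans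
    (iterateFrobeniusEquiv M p e).symm.toAddEquiv
  have hg (x : M) : A x = g x ^ p ^ e := by
    rw [← iterateFrobeniusEquiv_def]
    exact ((iterateFrobeniusEquiv M p e).apply_symm_apply (A x)).symm
  refine ⟨g, fun c v => (iterateFrobeniusEquiv M p e).injective ?_, hg⟩
  rw [iterateFrobeniusEquiv_def, iterateFrobeniusEquiv_def, ← hg, smul_pow, ← hg,
    ← iterateFrobeniusEquiv_def (R := K), RingEquiv.apply_symm_apply, map_smul]

end Semilinear

variable [Fintype K] [Field F] [Finite F] [Finite L] [Algebra K F] [Algebra F L]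
  [IsScalarTower K F L] {m n : ℕ} {κ : ℤ}

theorem coeffForm_pow_char_pow [NeZero m] (e : ℕ) (c : ZMod m → L) (x : F) (y : L) :
    coeffForm K F κ c x y ^ p ^ e = coeffForm K F κ (c ^ p ^ e) (x ^ p ^ e) (y ^ p ^ e) := by
  have := charP_of_algebra p K L
  rw [coeffForm_apply, coeffForm_apply, ← trace_pow_char_pow, mul_pow, linPoly_apply, linPoly_apply,
    sum_pow_char_pow]
  simp only [mul_pow, map_pow, Pi.pow_apply]

theorem pow_mem_twistedCoeff_iff {e t : ℕ} {μ : L} {s : ZMod n} {c : ZMod m → L} :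
    c ^ p ^ e ∈ twistedCoeff K m κ t (μ ^ p ^ e) s ↔ c ∈ twistedCoeff K m κ t μ s := by
  have := charP_of_algebra p K L
  have hpe : p ^ e ≠ 0 := pow_ne_zero _ (Fact.out : p.Prime).ne_zero
  simp only [mem_twistedCoeff_iff, Pi.pow_apply, pow_eq_zero_iff hpe]
  rw [map_pow, ← mul_pow, map_pow]
  exact and_congr_right fun _ => (iterateFrobenius_inj L p e).eq_iff

theorem image_puncturedTwistedGabidulin_eq_iff [NeZero m] [NeZero n] (hm : finrank K F = m)
    (hn : finrank K L = n) (hmn : m ∣ n) {k t : ℕ} (hk : IsCoprime (-k : ℤ) m) (ht : 1 ≤ t)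
    (htm : t < m) {μ ν : L} {s u : ℤ} {e : ℕ} {a : ZMod m → F} {b : ZMod n → L}
    {τ : (F →ₗ[K] L →ₗ[K] K) ≃+ (F →ₗ[K] L →ₗ[K] K)}
    (hτ : ∀ c, τ (coeffForm K F (-k) c) =
      coeffForm K F (-k) (linComp K (-k) hmn b (linComp K (-k) dvd_rfl (c ^ p ^ e) a))) :
    τ '' puncturedTwistedGabidulin K F L k t μ s = puncturedTwistedGabidulin K F L k t ν u ↔
      CompMapsTo K (-k) hmn a b t (μ ^ p ^ e) (s : ZMod n) ν (u : ZMod n) := by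
  have := charP_of_algebra p K L
  have hinj := coeffForm_injective (K := K) (L := L) hm hk
  rw [puncturedTwistedGabidulin_eq_map hm hn hmn k ht htm,
    puncturedTwistedGabidulin_eq_map hm hn hmn k ht htm, Submodule.map_coe, Submodule.map_coe]
  constructor
  · intro himg c' hc'
    obtain ⟨c, rfl⟩ : ∃ c, c ^ p ^ e = c' :=
      ⟨fun i => (iterateFrobeniusEquiv L p e).symm (c' i), funext fun i => by
        rw [Pi.pow_apply, ← iterateFrobeniusEquiv_def, RingEquiv.apply_symm_apply]⟩
    rw [pow_mem_twistedCoeff_iff] at hc'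
    have hmem := Set.mem_image_of_mem τ
      (Set.mem_image_of_mem (coeffForm K F (-k)) (SetLike.mem_coe.2 hc'))
    rw [himg, hτ] at hmem
    exact hinj.mem_set_image.1 hmem
  · intro h
    refine Set.eq_of_subset_of_ncard_le ?_ ?_ (Set.toFinite _)
    · rintro _ ⟨_, ⟨c, hc, rfl⟩, rfl⟩
      rw [hτ]
      exact Set.mem_image_of_mem _ (h _ ((pow_mem_twistedCoeff_iff p).2 hc))
    · have hτinj : Function.Injective (τ ∘ coeffForm K F (-k : ℤ)) := τ.injective.comp hinj
      have hcard := ncard_twistedCoeff_le (K := K) (κ := -k) ht htm ν μ (u : ZMod n) s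
      rwa [← Set.ncard_image_of_injective _ hinj, ← Set.ncard_image_of_injective _ hτinj,
        Set.image_comp] at hcard

theorem productEquiv_iff_exists_compMapsTo [NeZero m] [NeZero n] (hm : finrank K F = m)
    (hn : finrank K L = n) (hmn : m ∣ n) {k t : ℕ} (hk : IsCoprime (-k : ℤ) n) (ht : 1 ≤ t)
    (htm : t < m) {μ ν : L} {s u : ℤ} :
    ProductEquiv (puncturedTwistedGabidulin K F L k t μ s : Set (F →ₗ[K] L →ₗ[K] K))
        (puncturedTwistedGabidulin K F L k t ν u) ↔
      ∃ (e : ℕ) (a : ZMod m → F) (g : ZMod n → L), Function.Injective (linPoly K F (-k) a) ∧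
        Function.Injective (linPoly K L (-k) g) ∧
        CompMapsTo K (-k) hmn a (adjCoeff K (-k) g) t (μ ^ p ^ e) (s : ZMod n) ν (u : ZMod n) := by
  have hkm : IsCoprime (-k : ℤ) m :=
    hk.of_isCoprime_of_dvd_right (Int.natCast_dvd_natCast.2 hmn)
  have hτ {θ : K ≃+* K} {e : ℕ} (hθ : ∀ c, θ c = c ^ p ^ e) {g : F ≃+ F} {g' : L ≃+ L}
      {a : ZMod m → F} {b : ZMod n → L} (ha : ∀ x, linPoly K F (-k) a x = g x ^ p ^ e)
      (hb : ∀ y, linPoly K L (-k) b y = g' y ^ p ^ e)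
      {τ : (F →ₗ[K] L →ₗ[K] K) ≃+ (F →ₗ[K] L →ₗ[K] K)}
      (hτ : ∀ f x y, τ f x y = θ (f (g x) (g' y))) (c : ZMod m → L) :
      τ (coeffForm K F (-k) c) = coeffForm K F (-k)
        (linComp K (-k) hmn (adjCoeff K (-k) b) (linComp K (-k) dvd_rfl (c ^ p ^ e) a)) := by
    ext x y
    rw [hτ, hθ, coeffForm_pow_char_pow, ← ha, ← hb, coeffForm_comp hm hn hmn]
  constructor
  · rintro ⟨τ, ⟨θ, g, g', hg, hg', hτ'⟩, himg⟩
    obtain ⟨e, hθ⟩ := exists_ringEquiv_eq_pow p θ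
    obtain ⟨A, hA, hAg⟩ := exists_linearMap_eq_pow p hθ hg
    obtain ⟨B, hB, hBg⟩ := exists_linearMap_eq_pow p hθ hg'
    obtain ⟨a, rfl⟩ := linPoly_surjective hm hkm A
    obtain ⟨b, rfl⟩ := linPoly_surjective hn hk B
    exact ⟨e, a, b, hA, hB, (image_puncturedTwistedGabidulin_eq_iff p hm hn hmn hkm ht htm
      (hτ hθ hAg hBg hτ')).1 himg⟩
  · rintro ⟨e, a, b, hA, hB, h⟩
    obtain ⟨g, hg, hAg⟩ := exists_addEquiv_pow_eq p e hA
    obtain ⟨g', hg', hBg⟩ := exists_addEquiv_pow_eq p e hB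
    exact ⟨_, isProductAut_productAut hg hg', (image_puncturedTwistedGabidulin_eq_iff p hm hn hmn
      hkm ht htm (hτ (iterateFrobeniusEquiv_def K p e) hAg hBg (productAut_apply hg hg'))).2 h⟩

end PowerMaps

section Circulant

open Module

variable {K L : Type*} [Field K] [Fintype K] [Field L] [Finite L] [Algebra K L]
  {n : ℕ}

theorem circulant_apply (hn : finrank K L = n) (k : ℕ) (b : ZMod n → L) (i j : Fin n) :
    circulant K L k b i j = twist K k (i.val : ZMod n) (b (j.val - i.val)) := by
  rw [circulant, Matrix.of_apply, ← Int.cast_natCast i.val, twist_intCast hn, Nat.cast_mul]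

variable [NeZero n]

theorem bijective_natCast_val : Function.Bijective fun i : Fin n => (i.val : ZMod n) := by
  rw [Fintype.bijective_iff_surjective_and_card, Fintype.card_fin, ZMod.card]
  exact ⟨fun z => ⟨⟨z.val, ZMod.val_lt z⟩, ZMod.natCast_zmod_val z⟩, rfl⟩

theorem vecMul_circulant (hn : finrank K L = n) (k : ℕ) (v b : ZMod n → L) (j : Fin n) :
    Matrix.vecMul (fun i => v i.val) (circulant K L k b) j =
      linComp K k dvd_rfl v b (j.val : ZMod n) := by
  simp only [Matrix.vecMul, dotProduct, circulant_apply hn, linComp, ZMod.castHom_self,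
    RingHom.id_apply, Algebra.algebraMap_self_apply]
  exact bijective_natCast_val.sum_comp fun z : ZMod n => v z * twist K k z (b (j.val - z))

theorem circulant_det_ne_zero_iff (hn : finrank K L = n) {k : ℕ} (hk : IsCoprime (k : ℤ) n)
    (b : ZMod n → L) :
    (circulant K L k b).det ≠ 0 ↔ Function.Injective (linPoly K L k b) := by
  have hcomp (v : ZMod n → L) (x : L) :
      linPoly K L k v (linPoly K L k b x) = linPoly K L k (linComp K k dvd_rfl v b) x :=
    LinearMap.congr_fun (linPoly_comp hn hn dvd_rfl v b) x
  have hvec (w : Fin n → L) : ∃ v : ZMod n → L, (fun i => v i.val) = w :=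
    bijective_natCast_val.injective.surjective_comp_right w
  have hlin {v c : ZMod n → L}
      (h : Matrix.vecMul (fun i => v i.val) (circulant K L k b) = fun j => c j.val) :
      linComp K k dvd_rfl v b = c :=
    bijective_natCast_val.surjective.injective_comp_right <| funext fun j =>
      (vecMul_circulant hn k v b j).symm.trans (congrFun h j)
  constructor
  · intro hdet
    obtain ⟨w, hw⟩ := Matrix.vecMul_surjective_iff_isUnit.2
      ((Matrix.isUnit_iff_isUnit_det _).2 hdet.isUnit) fun j => (Pi.single 0 1 : ZMod n → L) j.val
    obtain ⟨v, rfl⟩ := hvec w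
    refine Function.LeftInverse.injective (g := linPoly K L k v) fun x => ?_
    rw [hcomp, hlin hw, linPoly_single, twist_zero, one_mul, Algebra.algebraMap_self_apply]
  · intro hinj hdet
    obtain ⟨w, hw0, hw⟩ := Matrix.exists_vecMul_eq_zero_iff.2 hdet
    obtain ⟨v, rfl⟩ := hvec w
    refine hw0 ?_
    have hv0 : v = 0 := by
      refine linPoly_injective (K := K) hn hk (LinearMap.ext fun x => ?_)
      obtain ⟨y, rfl⟩ := Finite.injective_iff_surjective.1 hinj x
      rw [hcomp, hlin (c := 0) hw, map_zero, LinearMap.zero_apply, LinearMap.zero_apply]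
    rw [hv0]
    rfl

end Circulant

section Condition

open Module

theorem castHom_natCast_mul {m n : ℕ} (hmn : m ∣ n) (h : ℕ) :
    ZMod.castHom hmn (ZMod m) ((h * m : ℕ) : ZMod n) = 0 := by
  rw [map_natCast, Nat.cast_mul, ZMod.natCast_self, mul_zero]

theorem castHom_eq_zero_iff {m n : ℕ} [NeZero n] (hmn : m ∣ n) {l : ZMod n} :
    ZMod.castHom hmn (ZMod m) l = 0 ↔
      ∃ h ∈ Finset.range (n / m), l = ((h * m : ℕ) : ZMod n) := by
  constructor
  · intro hl
    have hd : m ∣ l.val := by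
      rw [← ZMod.natCast_eq_zero_iff, ← map_natCast (ZMod.castHom hmn (ZMod m)),
        ZMod.natCast_zmod_val, hl]
    refine ⟨l.val / m, Finset.mem_range.2 (Nat.div_lt_div_of_lt_of_dvd hmn (ZMod.val_lt l)), ?_⟩
    rw [Nat.div_mul_cancel hd, ZMod.natCast_zmod_val]
  · rintro ⟨h, -, rfl⟩
    exact castHom_natCast_mul hmn h

theorem apply_eq_zero_and_apply_sub_eq_zero {R : Type*} [Zero R] {m n : ℕ} {hmn : m ∣ n}
    {b : ZMod n → R} {s u l : ZMod n}
    (hb : ∀ l, b l ≠ 0 → ZMod.castHom hmn (ZMod m) l = 0)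
    (hsu : ZMod.castHom hmn (ZMod m) s = ZMod.castHom hmn (ZMod m) u)
    (hl : ZMod.castHom hmn (ZMod m) l ≠ 0) : b l = 0 ∧ b (l - (s - u)) = 0 := by
  refine ⟨not_imp_comm.1 (hb _) hl, not_imp_comm.1 (hb _) ?_⟩
  rwa [map_sub, map_sub, hsu, sub_self, sub_zero]

variable {K F L : Type*} [Field K] [Fintype K] [Field F] [Field L] [Finite L] [Algebra K L]
  [Algebra F L] {m n : ℕ}

theorem frobPow_natCast_mul (hn : finrank K L = n) (k : ℕ) (z : ℤ) :
    (frobPow K (k * z) : L ≃ₐ[K] L) = twist K (-k) (-(z : ZMod n)) := by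
  rw [← Int.cast_neg, twist_intCast hn, neg_mul_neg]

/-- The relation between `a`, `b`, `μ` and `ν` in the equivalence condition, for an arbitrary
residue `l` modulo `n` in place of the multiple `h m` of `m`, and with `κ` in place of `-k`. -/
def EquivRelation (K : Type*) {F L : Type*} [Field K] [Fintype K] [Field F] [Field L] [Finite L]
    [Algebra K L] [Algebra F L] {n : ℕ} (κ : ℤ) (a : F) (i : ZMod n) (b : ZMod n → L) (t : ℕ)
    (μ : L) (s : ZMod n) (ν : L) (u l : ZMod n) : Prop :=
  algebraMap F L a * twist K κ (l - i) μ * twist K κ (l - (t : ZMod n)) (b l) =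
    twist K κ (-u) (algebraMap F L a) * ν * twist K κ (l - s) (b (l - (s - u)))

theorem equivRelation_natCast_mul_iff (hn : finrank K L = n) (hmn : m ∣ n) {k j h t : ℕ}
    {s u i : ℤ} (hs : (s : ZMod n) - u = (j * m : ℕ)) {a : F} {b : ZMod n → L} {μ ν : L} :
    EquivRelation K (-k) a (i : ZMod n) b t μ s ν u (h * m : ℕ) ↔
      algebraMap F L a * frobPow K (k * ((((n / m : ℕ) : ℤ) - h) * m + i)) μ *
          frobPow K (k * ((((n / m : ℕ) : ℤ) - h) * m + t)) (b ((h * m : ℕ) : ZMod n)) =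
        frobPow K (k * u) (algebraMap F L a) * ν *
          frobPow K (k * (((j : ℤ) - h) * m + u)) (b (((h : ZMod n) - (j : ZMod n)) * m)) := by
  have hrm : ((n / m : ℕ) : ZMod n) * m = 0 := by
    rw [← Nat.cast_mul, Nat.div_mul_cancel hmn, ZMod.natCast_self]
  have hleft (z : ℤ) : -(((((n / m : ℕ) : ℤ) - h) * m + z : ℤ) : ZMod n) = (h * m : ℕ) - z := by
    simp only [Int.cast_add, Int.cast_mul, Int.cast_sub, Int.cast_natCast, Nat.cast_mul]
    linear_combination -hrm
  have hright : -((((j : ℤ) - h) * m + u : ℤ) : ZMod n) = (h * m : ℕ) - s := by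
    push_cast at hs ⊢
    linear_combination hs
  have hindex : ((h : ZMod n) - j) * m = (h * m : ℕ) - (s - u) := by
    push_cast at hs ⊢
    linear_combination hs
  simp only [EquivRelation, frobPow_natCast_mul hn, hleft, hright, hindex, Int.cast_natCast]

theorem equivRelation_of_castHom_ne_zero {hmn : m ∣ n} {κ : ℤ} {a : F} {i s u l : ZMod n}
    {b : ZMod n → L} {t : ℕ} {μ ν : L} (hb : ∀ l, b l ≠ 0 → ZMod.castHom hmn (ZMod m) l = 0)
    (hsu : ZMod.castHom hmn (ZMod m) s = ZMod.castHom hmn (ZMod m) u)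
    (hl : ZMod.castHom hmn (ZMod m) l ≠ 0) : EquivRelation K κ a i b t μ s ν u l := by
  obtain ⟨hbl, hbl'⟩ := apply_eq_zero_and_apply_sub_eq_zero hb hsu hl
  rw [EquivRelation, hbl, hbl', map_zero, map_zero, mul_zero, mul_zero]

variable [NeZero n]

theorem equivCondition_iff (p : ℕ) (hn : finrank K L = n) (hmn : m ∣ n) {k : ℕ}
    (hk : IsCoprime (k : ℤ) n) {t : ℕ} {μ ν : L} {s u : ℤ} :
    EquivCondition K F L p m n k t μ ν s u ↔
      ∃ (e : ℕ) (i : ZMod n) (a : F) (b : ZMod n → L),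
        ZMod.castHom hmn (ZMod m) s = ZMod.castHom hmn (ZMod m) u ∧ a ≠ 0 ∧
        (∀ l, b l ≠ 0 → ZMod.castHom hmn (ZMod m) l = 0) ∧
        Function.Injective (linPoly K L k b) ∧
        ∀ l, EquivRelation K (-k) a i b t (μ ^ p ^ e) s ν u l := by
  have hsub (j : ℕ) : s ≡ u + j * m [ZMOD n] ↔ (s : ZMod n) - u = (j * m : ℕ) := by
    rw [← ZMod.intCast_eq_intCast_iff, sub_eq_iff_eq_add']
    push_cast
    rfl
  constructor
  · rintro ⟨j, hj, hs, e, i, a, b, ha, hb, hdet, h⟩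
    rw [hsub] at hs
    have hsu : ZMod.castHom hmn (ZMod m) s = ZMod.castHom hmn (ZMod m) u := by
      rw [← sub_eq_zero, ← map_sub]
      exact (castHom_eq_zero_iff hmn).2 ⟨j, hj, hs⟩
    have hb' (l) (hl : b l ≠ 0) : ZMod.castHom hmn (ZMod m) l = 0 := by
      obtain ⟨d, rfl⟩ := hb l hl
      exact castHom_natCast_mul hmn d
    refine ⟨e, i, a, b, hsu, ha, hb', (circulant_det_ne_zero_iff hn hk b).1 hdet, fun l => ?_⟩
    by_cases hl : ZMod.castHom hmn (ZMod m) l = 0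
    · obtain ⟨d, hd, rfl⟩ := (castHom_eq_zero_iff hmn).1 hl
      exact (equivRelation_natCast_mul_iff hn hmn hs).2 (h d hd)
    · exact equivRelation_of_castHom_ne_zero hb' hsu hl
  · rintro ⟨e, i, a, b, hsu, ha, hb, hinj, h⟩
    rw [← sub_eq_zero, ← map_sub] at hsu
    obtain ⟨j, hj, hs⟩ := (castHom_eq_zero_iff hmn).1 hsu
    obtain ⟨i, rfl⟩ := ZMod.intCast_surjective i
    refine ⟨j, hj, (hsub j).2 hs, e, i, a, b, ha, fun l hl => ?_,
      (circulant_det_ne_zero_iff hn hk b).2 hinj,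
      fun d _ => (equivRelation_natCast_mul_iff hn hmn hs).1 (h _)⟩
    obtain ⟨d, -, hd⟩ := (castHom_eq_zero_iff hmn).1 (hb l hl)
    exact ⟨d, hd⟩

end Condition

section Equivalence

open Module

variable {K L : Type*} [Field K] [Fintype K] [Field L] [Finite L] [Algebra K L] {m n : ℕ} {κ : ℤ}

theorem twist_neg_neg (hn : finrank K L = n) (z : ZMod n) :
    (twist K (-κ) (-z) : L ≃ₐ[K] L) = twist K κ z := by
  obtain ⟨z, rfl⟩ := ZMod.intCast_surjective z
  rw [← Int.cast_neg, twist_intCast hn, twist_intCast hn, neg_mul_neg]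

theorem adjCoeff_ne_zero {g : ZMod n → L} (hg : g ≠ 0) : adjCoeff K κ g ≠ 0 := by
  obtain ⟨l, hl⟩ := Function.ne_iff.1 hg
  refine Function.ne_iff.2 ⟨-l, ?_⟩
  rwa [adjCoeff, neg_neg, Pi.zero_apply, EmbeddingLike.map_ne_zero_iff]

variable (K) in
/-- The coefficients, with respect to `κ`, of the linearized polynomial `y ↦ P(y)^{(i)}`, where
`P` has coefficients `c` with respect to `-κ`; see `linPoly_reflectCoeff`. This substitution
relates the second factor of a product transformation to the circulant array `b`. -/
def reflectCoeff (κ : ℤ) (i : ZMod n) (c : ZMod n → L) : ZMod n → L := fun x =>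
  twist K κ i (c (i - x))

theorem reflectCoeff_surjective (i : ZMod n) :
    Function.Surjective (reflectCoeff K κ i : (ZMod n → L) → ZMod n → L) := fun g =>
  ⟨fun l => (twist K κ i).symm (g (i - l)), funext fun x => by
    rw [reflectCoeff, sub_sub_cancel, AlgEquiv.apply_symm_apply]⟩

theorem adjCoeff_reflectCoeff (hn : finrank K L = n) (i : ZMod n) (c : ZMod n → L) (l : ZMod n) :
    adjCoeff K κ (reflectCoeff K κ i c) l = twist K κ (l + i) (c (l + i)) := by
  rw [adjCoeff, reflectCoeff, ← twist_add hn, sub_neg_eq_add, add_comm i]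

theorem adjCoeff_reflectCoeff_ne_zero_iff (hn : finrank K L = n) {i : ZMod n} {c : ZMod n → L}
    {l : ZMod n} : adjCoeff K κ (reflectCoeff K κ i c) l ≠ 0 ↔ c (l + i) ≠ 0 := by
  rw [adjCoeff_reflectCoeff hn, EmbeddingLike.map_ne_zero_iff]

variable [NeZero n]

theorem linPoly_reflectCoeff (hn : finrank K L = n) (i : ZMod n) (c : ZMod n → L) (y : L) :
    linPoly K L κ (reflectCoeff K κ i c) y = twist K κ i (linPoly K L (-κ) c y) := by
  simp only [linPoly_self_apply, map_sum, map_mul]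
  refine Fintype.sum_equiv (Equiv.subLeft i) _ _ fun x => ?_
  rw [Equiv.subLeft_apply, reflectCoeff, ← neg_sub x i, twist_neg_neg hn, ← twist_add hn,
    add_sub_cancel]

theorem injective_linPoly_reflectCoeff_iff (hn : finrank K L = n) {i : ZMod n} {c : ZMod n → L} :
    Function.Injective (linPoly K L κ (reflectCoeff K κ i c)) ↔
      Function.Injective (linPoly K L (-κ) c) := by
  have h : ⇑(linPoly K L κ (reflectCoeff K κ i c)) = twist K κ i ∘ linPoly K L (-κ) c :=
    funext (linPoly_reflectCoeff hn i c)
  rw [h]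
  exact (twist K κ i).injective.of_comp_iff _

variable {F : Type*} [Field F] [Finite F] [Algebra K F] [Algebra F L] [NeZero m]
  {hmn : m ∣ n} {a : F} {i s u : ZMod n} {c : ZMod n → L} {t : ℕ} {μ ν : L}

theorem compMapsTo_reflectCoeff_iff
    (hm : finrank K F = m) (hn : finrank K L = n) (hκ : IsCoprime κ n) (ht : 1 ≤ t) (htm : t < m)
    (hc : ∀ l, c l ≠ 0 → ZMod.castHom hmn (ZMod m) l = 0) :
    CompMapsTo K κ hmn
        (Pi.single (ZMod.castHom hmn (ZMod m) i) (twist K κ (ZMod.castHom hmn (ZMod m) i) a))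
        (adjCoeff K κ (reflectCoeff K κ i c)) t μ s ν u ↔
      ∀ l, twist K κ (l - (t : ZMod n)) (c l) *
          (twist K κ (l - i) μ * twist K κ l (algebraMap F L a)) =
        ν * twist K κ (l - s) (c (l - (s - u))) * twist K κ (l - s) (algebraMap F L a) := by
  have hb (l) (hl : adjCoeff K κ (reflectCoeff K κ i c) l ≠ 0) :
      ZMod.castHom hmn (ZMod m) l = -ZMod.castHom hmn (ZMod m) i := by
    have hli := hc _ ((adjCoeff_reflectCoeff_ne_zero_iff hn).1 hl)
    rwa [map_add, ← eq_neg_iff_add_eq_zero] at hli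
  rw [compMapsTo_single_iff hm hn hκ ht htm hb, ← (Equiv.subRight (i + s)).forall_congr_right]
  refine forall_congr' fun l => ?_
  rw [Equiv.subRight_apply, adjCoeff_reflectCoeff hn, adjCoeff_reflectCoeff hn, map_mul,
    ← twist_algebraMap hm hn hmn]
  simp only [← twist_add hn]
  rw [show -t + (l - (i + s) + s + i) = l - (t : ZMod n) by ring,
    show l - (i + s) + s + i = l by ring, show l - (i + s) + s = l - i by ring,
    show -u + (l - (i + s) + u + i) = l - s by ring,
    show l - (i + s) + u + i = l - (s - u) by ring, show l - (i + s) + i = l - s by ring]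

theorem compMapsTo_reflectCoeff_iff_equivRelation
    (hm : finrank K F = m) (hn : finrank K L = n) (hκ : IsCoprime κ n) (ht : 1 ≤ t) (htm : t < m)
    (hc : ∀ l, c l ≠ 0 → ZMod.castHom hmn (ZMod m) l = 0)
    (hsu : ZMod.castHom hmn (ZMod m) s = ZMod.castHom hmn (ZMod m) u) :
    CompMapsTo K κ hmn
        (Pi.single (ZMod.castHom hmn (ZMod m) i) (twist K κ (ZMod.castHom hmn (ZMod m) i) a))
        (adjCoeff K κ (reflectCoeff K κ i c)) t μ s ν u ↔
      ∀ l, EquivRelation K κ a i c t μ s ν u l := by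
  rw [compMapsTo_reflectCoeff_iff hm hn hκ ht htm hc]
  refine forall_congr' fun l => ?_
  by_cases hl : ZMod.castHom hmn (ZMod m) l = 0
  · have htwist {x y : ZMod n} (h : ZMod.castHom hmn (ZMod m) x = ZMod.castHom hmn (ZMod m) y) :
        twist K κ x (algebraMap F L a) = twist K κ y (algebraMap F L a) := by
      rw [twist_algebraMap hm hn hmn, twist_algebraMap hm hn hmn, h]
    have hl0 : twist K κ l (algebraMap F L a) = algebraMap F L a := by
      rw [htwist (hl.trans (map_zero _).symm), twist_zero]
    have hls : twist K κ (l - s) (algebraMap F L a) = twist K κ (-u) (algebraMap F L a) :=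
      htwist (by rw [map_sub, hl, hsu, zero_sub, map_neg])
    rw [EquivRelation, hl0, hls]
    constructor <;> intro h <;> linear_combination h
  · obtain ⟨hcl, hcl'⟩ := apply_eq_zero_and_apply_sub_eq_zero hc hsu hl
    refine iff_of_true ?_ (equivRelation_of_castHom_ne_zero hc hsu hl)
    rw [hcl, hcl', map_zero, map_zero, zero_mul, mul_zero, zero_mul]

theorem productEquiv_iff_equivCondition [IsScalarTower K F L] (p : ℕ) [Fact p.Prime] [CharP K p]
    (hm : finrank K F = m) (hn : finrank K L = n) (hmn : m ∣ n) {k : ℕ} (hk : IsCoprime (k : ℤ) n)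
    (ht : 1 ≤ t) (htm : t + 2 ≤ m) (hμ : μ ≠ 0) {s u : ℤ}
    (h0 : (s : ZMod m) ≠ 0) (h1 : (s : ZMod m) ≠ 1) (h1' : (s : ZMod m) ≠ -1)
    (h2 : (s : ZMod m) ≠ 2) (h2' : (s : ZMod m) ≠ -2) :
    ProductEquiv (puncturedTwistedGabidulin K F L k t μ s : Set (F →ₗ[K] L →ₗ[K] K))
        (puncturedTwistedGabidulin K F L k t ν u) ↔ EquivCondition K F L p m n k t μ ν s u := by
  have htm' : t < m := by omega
  have hk' : IsCoprime (-k : ℤ) n := hk.neg_left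
  rw [productEquiv_iff_exists_compMapsTo p hm hn hmn hk' ht htm', equivCondition_iff p hn hmn hk]
  refine exists_congr fun e => ?_
  have hμe : μ ^ p ^ e ≠ 0 := pow_ne_zero _ hμ
  rw [← map_intCast (ZMod.castHom hmn (ZMod m))] at h0 h1 h1' h2 h2'
  constructor
  · rintro ⟨a, g, ha, hg, h⟩
    have hg0 : g ≠ 0 := by
      rintro rfl
      exact one_ne_zero (hg (by simp only [map_zero, LinearMap.zero_apply]))
    obtain ⟨i, a, ha0, rfl, hb⟩ := h.exists_eq_single hm hn hk' ht htm hμe h0 h1 h1' h2 h2'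
      (Finite.injective_iff_surjective.1 ha) (adjCoeff_ne_zero hg0)
    have hsu := castHom_eq_castHom_of_forall_eq (α := algebraMap F L a)
      (by simpa using ha0) hμe (adjCoeff_ne_zero hg0) hb
      ((compMapsTo_single_iff hm hn hk' ht htm' hb).1 h)
    obtain ⟨i, rfl⟩ := ZMod.castHom_surjective hmn i
    obtain ⟨c, rfl⟩ := reflectCoeff_surjective (K := K) (κ := -k) i g
    obtain ⟨a, rfl⟩ := (twist K (-k) (ZMod.castHom hmn (ZMod m) i)).surjective a
    have hc (l) (hl : c l ≠ 0) : ZMod.castHom hmn (ZMod m) l = 0 := by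
      have hli := hb (l - i)
      rw [adjCoeff_reflectCoeff_ne_zero_iff hn, sub_add_cancel, map_sub, sub_eq_neg_self] at hli
      exact hli hl
    rw [injective_linPoly_reflectCoeff_iff hn, neg_neg] at hg
    exact ⟨i, a, c, hsu, (map_ne_zero _).1 ha0, hc, hg,
      (compMapsTo_reflectCoeff_iff_equivRelation hm hn hk' ht htm' hc hsu).1 h⟩
  · rintro ⟨i, a, c, hsu, ha0, hc, hinj, h⟩
    refine ⟨_, reflectCoeff K (-k) i c, ?_, ?_,
      (compMapsTo_reflectCoeff_iff_equivRelation hm hn hk' ht htm' hc hsu).2 h⟩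
    · exact injective_linPoly_single ((map_ne_zero _).2 ha0)
    · rwa [injective_linPoly_reflectCoeff_iff hn, neg_neg]

end Equivalence

end

end PuncturedCodes

open PuncturedCodes in
theorem mainTheorem5_general (p : ℕ) [Fact p.Prime]
    (K F L : Type*) [Field K] [Fintype K] [CharP K p] [Field F] [Field L] [Finite L]
    [Algebra K F] [Algebra K L] [Algebra F L] [IsScalarTower K F L]
    (m n : ℕ) (hm : Module.finrank K F = m) (hn : Module.finrank K L = n) (hmn : m ∣ n)
    (k : ℕ) (hk : Nat.Coprime k n) (t : ℕ) (ht1 : 1 ≤ t) (ht2 : t + 2 ≤ m) (s u : ℤ)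
    (hs0 : ¬ s ≡ 0 [ZMOD m]) (hs1 : ¬ s ≡ 1 [ZMOD m]) (hs1' : ¬ s ≡ -1 [ZMOD m])
    (hs2 : ¬ s ≡ 2 [ZMOD m]) (hs2' : ¬ s ≡ -2 [ZMOD m]) (μ ν : L) (hμ0 : μ ≠ 0) :
    (m < n →
      (CodeEquiv (puncturedTwistedGabidulin K F L k t μ s : Set (F →ₗ[K] L →ₗ[K] K))
          (puncturedTwistedGabidulin K F L k t ν u) ↔
        EquivCondition K F L p m n k t μ ν s u)) ∧
    (ProductEquiv (puncturedTwistedGabidulin K F L k t μ s : Set (F →ₗ[K] L →ₗ[K] K))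
        (puncturedTwistedGabidulin K F L k t ν u) ↔
      EquivCondition K F L p m n k t μ ν s u) := by
  have : Finite F := Finite.of_injective _ (algebraMap F L).injective
  have : NeZero m := ⟨by omega⟩
  have : NeZero n := ⟨hn ▸ Module.finrank_pos.ne'⟩
  have hne {z : ℤ} (h : ¬ s ≡ z [ZMOD m]) : (s : ZMod m) ≠ z := fun e =>
    h ((ZMod.intCast_eq_intCast_iff _ _ _).1 e)
  have hprod : ProductEquiv (puncturedTwistedGabidulin K F L k t μ s : Set (F →ₗ[K] L →ₗ[K] K))
      (puncturedTwistedGabidulin K F L k t ν u) ↔ EquivCondition K F L p m n k t μ ν s u :=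
    productEquiv_iff_equivCondition p hm hn hmn (Nat.isCoprime_iff_coprime.2 hk) ht1 ht2 hμ0
      (mod_cast hne hs0) (mod_cast hne hs1) (mod_cast hne hs1') (mod_cast hne hs2)
      (mod_cast hne hs2')
  exact ⟨fun hlt => (codeEquiv_iff_productEquiv (by rwa [hm, hn])).trans hprod, hprod⟩

theorem mainTheorem5 (p : ℕ) [Fact p.Prime]
    (K F L : Type*) [Field K] [Fintype K] [CharP K p] [Field F] [Field L] [Finite L]
    [Algebra K F] [Algebra K L] [Algebra F L] [IsScalarTower K F L]
    (m n : ℕ) (hm : Module.finrank K F = m) (hn : Module.finrank K L = n)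
    (hm1 : 1 < m) (hmn : m ∣ n)
    (k : ℕ) (hk0 : 0 < k) (hk : Nat.Coprime k n)
    (t : ℕ) (ht1 : 1 ≤ t) (ht2 : t ≤ m - 2)
    (s u : ℤ)
    (hs0 : ¬ s ≡ 0 [ZMOD m]) (hs1 : ¬ s ≡ 1 [ZMOD m]) (hs1' : ¬ s ≡ -1 [ZMOD m])
    (hs2 : ¬ s ≡ 2 [ZMOD m]) (hs2' : ¬ s ≡ -2 [ZMOD m])
    (μ ν : L) (hμ0 : μ ≠ 0)
    (hμ : Algebra.norm K μ ≠ (-1) ^ (n * t)) (hν : Algebra.norm K ν ≠ (-1) ^ (n * t)) :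
    (m < n →
      (PuncturedCodes.CodeEquiv
          (PuncturedCodes.puncturedTwistedGabidulin K F L k t μ s : Set (F →ₗ[K] L →ₗ[K] K))
          (PuncturedCodes.puncturedTwistedGabidulin K F L k t ν u : Set (F →ₗ[K] L →ₗ[K] K)) ↔
        PuncturedCodes.EquivCondition K F L p m n k t μ ν s u)) ∧
    (m = n →
      (PuncturedCodes.ProductEquiv
          (PuncturedCodes.puncturedTwistedGabidulin K F L k t μ s : Set (F →ₗ[K] L →ₗ[K] K))
          (PuncturedCodes.puncturedTwistedGabidulin K F L k t ν u : Set (F →ₗ[K] L →ₗ[K] K)) ↔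
        PuncturedCodes.EquivCondition K F L p m n k t μ ν s u)) :=
  (mainTheorem5_general p K F L m n hm hn hmn k hk t ht1 (by omega) s u
    hs0 hs1 hs1' hs2 hs2' μ ν hμ0).imp_right fun h _ => h
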